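/- **Setting.** Let $\mathfrak g$ be a Lie algebra over a field $k$ of characteristic zero with a finite basis $\hat x_1,\dots,\hat x_n$, and let $[\hat x_i,\hat x_j]=\sum_l C^l_{ij}\hat x_l$. Let $\partial^1,\dots,\partial^n$ be the dual basis of $\mathfrak g^*$. Put $S(\mathfrak g)=k[x_1,\dots,x_n]$ and $\hat S(\mathfrak g^*)=k[[\partial^1,\dots,\partial^n]]$, where $\partial^\mu$ acts on $S(\mathfrak g)$ as $\partial/\partial x_\mu$. Let $\xi:S(\mathfrak g)\to U(\mathfrak g)$ be the coexponential (symmetrization) map, i.e. the linear map with $$\xi(x_{i_1}\cdots x_{i_r})=\frac1{r!}\sum_{\sigma\in\Sigma(r)}\hat x_{i_{\sigma 1}}\cdots\hat x_{i_{\sigma r}} .$$ It is a linear isomorphism. For $P\in\hat S(\mathfrak g^*)$ let $\hat P=\xi P\xi^{-1}\in\operatorname{End}_k U(\mathfrak g)$; in particular $\hat\partial^\mu=\xi\,\partial^\mu\,\xi^{-1}$. In the same way (using $\xi\otimes\xi$), every element of the completed tensor product $\hat S(\mathfrak g^*)\hat\otimes\hat S(\mathfrak g^*)$ acts on $U(\mathfrak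 g)\otimes U(\mathfrak g)$. Elements of $U(\mathfrak g)$ act on $U(\mathfrak g)$ by left multiplication, and brackets are commutators in $\operatorname{End}_k U(\mathfrak g)$. The deformed coproduct of $\hat\partial^\mu$ is the element $\Delta\hat\partial^\mu=\sum\hat\partial^\mu_{(1)}\otimes\hat\partial^\mu_{(2)}$ of $\hat S(\mathfrak g^*)\hat\otimes\hat S(\mathfrak g^*)$ such that $\hat\partial^\mu(uv)=\sum\hat\partial^\mu_{(1)}(u)\,\hat\partial^\mu_{(2)}(v)$ for all $u,v\in U(\mathfrak g)$. **Trees.** $\mathcal T^{\rm ord}$ is the set of planar rooted trees with white and black nodes, the black ones being leaves, together with a numbering of the white nodes by $1,\dots,w$ (each number used once) such that a white child always has a greater number than its parent; the tree consisting of one black node is included. For $t\in\mathcal T^{\rm ord}$ with $w$ white nodes and indices $\mu,\alpha_1,\dots,\alpha_w$, the element $\mathrm{ev}(t)^\mu_{\alpha_1,\dots,\alpha_w}\in S(\mathfrak g^*)$ is obtained as follows. Attach to the root an incoming line with label $\mu$ and label every inner line by an index. A white node with number $j$, incoming line $\rho$ and outgoing lines (from left to right) $\rho_1,\dots,\rho_s$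 contributes $$(-1)^s\frac{B_s}{s!}\sum_{l_1,\dots,l_{s-1}}C^{l_1}_{\alpha_j\rho_1}C^{l_2}_{l_1\rho_2}\cdots C^{\rho}_{l_{s-1}\rho_s}$$ (which means $\delta^\rho_{\alpha_j}$ if $s=0$), where $B_s$ are the Bernoulli numbers with $B_1=-\tfrac12$. A black leaf with incoming line $\rho$ contributes $\partial^\rho$. Multiply all contributions and sum over all labels of the inner lines. The full evaluation is $$\mathrm{fev}(t)^\mu=\frac1{w!}\sum_{\alpha_1,\dots,\alpha_w}\partial^{\alpha_1}\cdots\partial^{\alpha_w}\otimes\mathrm{ev}(t)^\mu_{\alpha_1,\dots,\alpha_w}.$$ **Theorem.** Let $1\le\mu\le n$. The map $\xi$ is bijective, every iterated commutator $[[\dots[\hat\partial^\mu,\hat x_{\alpha_1}],\dots],\hat x_{\alpha_w}]$ is of the form $\hat P$ with $P\in\hat S(\mathfrak g^*)$, and the deformed coproduct $\Delta\hat\partial^\mu$ exists, is unique, and satisfies the following. 1. As operators on $U(\mathfrak g)\otimes U(\mathfrak g)$, $$\Delta\hat\partial^\mu=\sum_{w=0}^\infty\frac1{w!}\sum_{\alpha_1,\dots,\alpha_w}\hat\partial^{\alpha_1}\cdots\hat\partial^{\alpha_w}\otimes[[\dots[\hat\partial^\mu,\hat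 x_{\alpha_1}],\dots],\hat x_{\alpha_w}],$$ where on each element only finitely many terms (in $w$) do not vanish. 2. Symbolically, $$\Delta\hat\partial^\mu=\exp\Big(\sum_\alpha\hat\partial^\alpha\otimes\operatorname{ad}(-\hat x_\alpha)\Big)(1\otimes\hat\partial^\mu).$$ That is, the powers of $\sum_\alpha\hat\partial^\alpha\otimes\operatorname{ad}(-\hat x_\alpha)$ are first applied to $1\otimes\hat\partial^\mu\in\operatorname{End}_kU(\mathfrak g)\otimes\operatorname{End}_kU(\mathfrak g)$, and the exponential series of the resulting operators on $U(\mathfrak g)\otimes U(\mathfrak g)$ is summed, with finitely many nonzero terms on each element. 3. In $\hat S(\mathfrak g^*)\hat\otimes\hat S(\mathfrak g^*)$, $$\Delta\hat\partial^\mu=\sum_{t\in\mathcal T^{\rm ord}}\mathrm{fev}(t)^\mu,$$ where only finitely many trees contribute to each coefficient. -/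

import Mathlib

open scoped TensorProduct Nat

namespace SymOrd

noncomputable section

/-! ### Constant coefficient differential operators of infinite order

The completed symmetric algebra of the dual space, with the dual basis `∂^1, …, ∂^n`, is
`MvPowerSeries (Fin n) k`; the symmetric algebra, with the basis `x_1, …, x_n`, is
`MvPolynomial (Fin n) k`. The completed tensor square of the former is
`MvPowerSeries (Fin n ⊕ Fin n) k`, where `Sum.inl` and `Sum.inr` mark the variables of the left
and of the right factor. -/

section DiffOp

variable {k : Type*} [Field k] {n : ℕ}

/-- The operator `P(∂)` on polynomials: on a monomial `x^a` it is the sum over all `m ≤ a` of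
`P_m ∂^m (x^a)`, where `∂^m (x^a) = (∏ i, a_i (a_i - 1) ⋯ (a_i - m_i + 1)) x^(a - m)`.
(The pairs `p` run over all decompositions `a = p.1 + p.2`, that is `m = p.1`, `a - m = p.2`.) -/
def diffOp (P : MvPowerSeries (Fin n) k) :
    MvPolynomial (Fin n) k →ₗ[k] MvPolynomial (Fin n) k :=
  (MvPolynomial.basisMonomials (Fin n) k).constr k fun a =>
    ∑ p ∈ Finset.HasAntidiagonal.antidiagonal a,
      MvPolynomial.monomial p.2
        (MvPowerSeries.coeff p.1 P * ((∏ i, (a i).descFactorial (p.1 i) : ℕ) : k))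

/-- The operator on `S ⊗ S` given by an element of the completed tensor square: it sends
`x^a ⊗ x^b` to the sum over `m ≤ a`, `l ≤ b` of `D_(m,l) ∂^m (x^a) ⊗ ∂^l (x^b)`. -/
def diffOp₂ (D : MvPowerSeries (Fin n ⊕ Fin n) k) :
    MvPolynomial (Fin n) k ⊗[k] MvPolynomial (Fin n) k →ₗ[k]
      MvPolynomial (Fin n) k ⊗[k] MvPolynomial (Fin n) k :=
  ((MvPolynomial.basisMonomials (Fin n) k).tensorProduct
      (MvPolynomial.basisMonomials (Fin n) k)).constr k fun ab =>
    ∑ p ∈ Finset.HasAntidiagonal.antidiagonal ab.1, ∑ q ∈ Finset.HasAntidiagonal.antidiagonal ab.2,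
      MvPowerSeries.coeff (Finsupp.sumElim p.1 q.1) D •
        (diffOp (MvPowerSeries.monomial p.1 (1 : k)) (MvPolynomial.monomial ab.1 1) ⊗ₜ[k]
          diffOp (MvPowerSeries.monomial q.1 (1 : k)) (MvPolynomial.monomial ab.2 1))

end DiffOp

/-! ### Infinite sums -/

/-- `S = ∑ s, T s`, where on every vector only finitely many summands do not vanish. -/
def HasPointwiseSum {k V σ : Type*} [Field k] [AddCommGroup V] [Module k V]
    (T : σ → Module.End k V) (S : Module.End k V) : Prop :=
  ∀ z : V, {s | T s z ≠ 0}.Finite ∧ S z = ∑ᶠ s, T s z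

/-- `D = ∑ s, f s` in a ring of formal power series, where to every coefficient only finitely
many summands contribute. -/
def HasFormalSum {k σ τ : Type*} [Field k] (f : σ → MvPowerSeries τ k)
    (D : MvPowerSeries τ k) : Prop :=
  ∀ m : τ →₀ ℕ, {s | MvPowerSeries.coeff m (f s) ≠ 0}.Finite ∧
    MvPowerSeries.coeff m D = ∑ᶠ s, MvPowerSeries.coeff m (f s)

/-! ### The coexponential map and the deformed derivatives -/

section Deformed

variable {k g : Type*} [Field k] [LieRing g] [LieAlgebra k g] {n : ℕ}
  (b : Module.Basis (Fin n) k g)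

/-- The generators `x̂_i` of the enveloping algebra. -/
def xhat (i : Fin n) : UniversalEnvelopingAlgebra k g := UniversalEnvelopingAlgebra.ι k (b i)

/-- The coexponential (symmetrization) map from the symmetric algebra to the enveloping algebra:
`x_{i_1} ⋯ x_{i_r} ↦ (1 / r!) ∑ σ, x̂_{i_{σ 1}} ⋯ x̂_{i_{σ r}}`. -/
def coexp : MvPolynomial (Fin n) k →ₗ[k] UniversalEnvelopingAlgebra k g :=
  (MvPolynomial.basisMonomials (Fin n) k).constr k fun m =>
    ((m.toMultiset.toList.length ! : ℕ) : k)⁻¹ •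
      ∑ σ : Equiv.Perm (Fin m.toMultiset.toList.length),
        (List.ofFn fun i => xhat b (m.toMultiset.toList.get (σ i))).prod

open Classical in
/-- The inverse of the coexponential map (which is bijective in characteristic zero). -/
def coexpInv : UniversalEnvelopingAlgebra k g →ₗ[k] MvPolynomial (Fin n) k :=
  if h : Function.Bijective (coexp b) then (LinearEquiv.ofBijective (coexp b) h).symm else 0

/-- The deformed derivative `∂̂^μ`, given by `∂̂^μ (ξ f) = ξ (∂^μ f)`. -/
def dhat (μ : Fin n) : Module.End k (UniversalEnvelopingAlgebra k g) :=
  coexp b ∘ₗ (MvPolynomial.pderiv μ).toLinearMap ∘ₗ coexpInv b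

/-- The operator `P(∂̂)` on the enveloping algebra given by a formal power series `P`. -/
def hat (P : MvPowerSeries (Fin n) k) : Module.End k (UniversalEnvelopingAlgebra k g) :=
  coexp b ∘ₗ diffOp P ∘ₗ coexpInv b

/-- The operator on the tensor square of the enveloping algebra given by an element of the
completed tensor square of the algebra of formal power series in the `∂`'s. -/
def hat₂ (D : MvPowerSeries (Fin n ⊕ Fin n) k) :
    Module.End k (UniversalEnvelopingAlgebra k g ⊗[k] UniversalEnvelopingAlgebra k g) :=
  TensorProduct.map (coexp b) (coexp b) ∘ₗ diffOp₂ D ∘ₗ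
    TensorProduct.map (coexpInv b) (coexpInv b)

/-- `D` is the deformed coproduct of `∂̂^μ`: the deformed Leibniz rule
`∂̂^μ (u v) = ∑ D_(1)(u) D_(2)(v)` holds. -/
def IsDeformedCoproduct (μ : Fin n) (D : MvPowerSeries (Fin n ⊕ Fin n) k) : Prop :=
  ∀ u v : UniversalEnvelopingAlgebra k g,
    dhat b μ (u * v) = LinearMap.mul' k (UniversalEnvelopingAlgebra k g) (hat₂ b D (u ⊗ₜ[k] v))

/-- The element `x̂_i` acting on the enveloping algebra by left multiplication. -/
def xop (i : Fin n) : Module.End k (UniversalEnvelopingAlgebra k g) :=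
  LinearMap.mulLeft k (xhat b i)

/-- `[[…[∂̂^μ, x̂_{α_1}], …], x̂_{α_w}]`. -/
def nestedBracket (μ : Fin n) {w : ℕ} (α : Fin w → Fin n) :
    Module.End k (UniversalEnvelopingAlgebra k g) :=
  (List.ofFn α).foldl (fun T i => T * xop b i - xop b i * T) (dhat b μ)

/-- `(1 / w!) ∑ ∂̂^{α_1} ⋯ ∂̂^{α_w} ⊗ [[…[∂̂^μ, x̂_{α_1}], …], x̂_{α_w}]`, the sum being over all
`α_1, …, α_w`. -/
def bracketTerm (μ : Fin n) (w : ℕ) :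
    Module.End k (UniversalEnvelopingAlgebra k g ⊗[k] UniversalEnvelopingAlgebra k g) :=
  ((w ! : ℕ) : k)⁻¹ • ∑ α : Fin w → Fin n,
    TensorProduct.map (List.ofFn fun i => dhat b (α i)).prod (nestedBracket b μ α)

/-- `∑ α, ∂̂^α ⊗ ad (-x̂_α)`, acting on `End U ⊗ End U` by left multiplication with `∂̂^α` in the
left and by the commutator with `-x̂_α` in the right factor. -/
def expGenerator :
    Module.End k (Module.End k (UniversalEnvelopingAlgebra k g) ⊗[k]
      Module.End k (UniversalEnvelopingAlgebra k g)) :=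
  ∑ α : Fin n, TensorProduct.map (LinearMap.mulLeft k (dhat b α))
    (LinearMap.mulLeft k (-xop b α) - LinearMap.mulRight k (-xop b α))

/-- The `w`-th term of `exp (∑ α, ∂̂^α ⊗ ad (-x̂_α)) (1 ⊗ ∂̂^μ)`, as an operator on the tensor
square of the enveloping algebra. -/
def expTerm (μ : Fin n) (w : ℕ) :
    Module.End k (UniversalEnvelopingAlgebra k g ⊗[k] UniversalEnvelopingAlgebra k g) :=
  TensorProduct.homTensorHomMap (.id k) _ _ _ _
    ((((w ! : ℕ) : k)⁻¹ • expGenerator b ^ w) (1 ⊗ₜ[k] dhat b μ))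

end Deformed

/-! ### Trees and their evaluation -/

/-- Planar rooted trees with white nodes, carrying labels in `Λ`, and black nodes, which are
leaves. -/
inductive PlanarTree (Λ : Type) : Type
  | black : PlanarTree Λ
  | white (label : Λ) (s : ℕ) (child : Fin s → PlanarTree Λ) : PlanarTree Λ

namespace PlanarTree

/-- The labels of the white nodes, with multiplicities. -/
def labels {Λ : Type} : PlanarTree Λ → Multiset Λ
  | black => 0
  | white a _ c => a ::ₘ ∑ i, (c i).labels

/-- The label of the root, if the root is white. -/
def rootLabel {Λ : Type} : PlanarTree Λ → Option Λ
  | black => none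
  | white a _ _ => some a

/-- White children have greater labels than their parents. -/
def Descending {Λ : Type} [LT Λ] : PlanarTree Λ → Prop
  | black => True
  | white a _ c => ∀ i, (∀ l ∈ (c i).rootLabel, a < l) ∧ (c i).Descending

/-- Replace the labels. -/
def relabel {Λ Λ' : Type} (f : Λ → Λ') : PlanarTree Λ → PlanarTree Λ'
  | black => black
  | white a s c => white (f a) s fun i => (c i).relabel f

end PlanarTree

/-- Ordered planar trees: the `w` white nodes are numbered bijectively by `Fin w` such that white
children have greater numbers than their parents. -/
structure OrderedTree where
  w : ℕ
  tree : PlanarTree (Fin w)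
  numbering : tree.labels = (Finset.univ : Finset (Fin w)).val
  descending : tree.Descending

section Evaluation

variable {k g : Type*} [Field k] [LieRing g] [LieAlgebra k g] {n : ℕ}
  (b : Module.Basis (Fin n) k g)

/-- `C^l_{i j}`, where `[x̂_i, x̂_j] = ∑ l, C^l_{i j} x̂_l`. -/
def structConst (l i j : Fin n) : k := b.repr ⁅b i, b j⁆ l

/-- `∑ C^{l_1}_{a ρ_1} C^{l_2}_{l_1 ρ_2} ⋯ C^μ_{l_{s-1} ρ_s}` over all `l_1, …, l_{s-1}`, and the
Kronecker delta of `a` and `μ` if `s = 0`. -/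
def chain (μ : Fin n) : Fin n → List (Fin n) → k
  | a, [] => if a = μ then 1 else 0
  | a, ρ :: ρs => ∑ l, structConst b l a ρ * chain μ l ρs

/-- The value of a white node with label `a`, incoming line `μ` and outgoing lines
`ρ_1, …, ρ_s`. -/
def vertex (a μ : Fin n) {s : ℕ} (ρ : Fin s → Fin n) : k :=
  (-1) ^ s * (bernoulli s : k) / (s ! : ℕ) * chain b μ a (List.ofFn ρ)

/-- The evaluation of a tree whose white nodes are labelled by indices, the incoming line of the
root being labelled by `μ`: black leaves evaluate to `∂^ρ`, white nodes to `vertex`, and the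
product of all of these is summed over the labels `ρ` of all inner lines. -/
def ev : PlanarTree (Fin n) → Fin n → MvPolynomial (Fin n) k
  | .black, μ => MvPolynomial.X μ
  | .white a s c, μ =>
      ∑ ρ : Fin s → Fin n, MvPolynomial.C (vertex b a μ ρ) * ∏ i, ev (c i) (ρ i)

/-- The full evaluation
`fev(t)^μ = (1 / w!) ∑ ∂^{α_1} ⋯ ∂^{α_w} ⊗ ev(t)^μ_{α_1, …, α_w}` over all `α_1, …, α_w`. -/
def fev (t : OrderedTree) (μ : Fin n) : MvPolynomial (Fin n ⊕ Fin n) k :=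
  ((t.w ! : ℕ) : k)⁻¹ • ∑ α : Fin t.w → Fin n,
    (∏ i, MvPolynomial.X (Sum.inl (α i))) *
      MvPolynomial.rename Sum.inr (ev b (t.tree.relabel α) μ)

end Evaluation

end

end SymOrd

/-!
Write `∂^ρ` for the coordinates of the dual space, let `A` be the matrix of linear forms with
`A a l = -∑ ρ, C^l_{a ρ} ∂^ρ`, and let `φ = ∑ s, (B_s / s!) A ^ s`, the matrix `fieldMatrix`.

*The representation.* The operators `repOp α = ∑ ρ, x_ρ φ^ρ_α(∂)` on the symmetric algebra satisfy
the relations of the Lie algebra. Indeed this says that the formal vector fields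
`∑ ρ, φ^ρ_α ∂/∂(∂^ρ)` are closed under brackets, with the given structure constants up to sign
(`fieldMatrix_bracket`), and it is equivalent to the Maurer-Cartan equation for the inverse matrix
`∑ s, A ^ s / (s + 1)!`, which is shown by applying the Euler derivation: both sides of that
equation satisfy the same differential equation along rays (`maurerCartan`). So the
enveloping algebra acts on the symmetric algebra, and `u ↦ u · 1` is a left inverse of the
coexponential map: by polarization it is enough to check this on powers of linear forms `y`, and
there the element of the Lie algebra with the same coordinates as `y` acts on `y ^ r` as
multiplication by `y`, because `∑ α, y_α A(∂) α l` annihilates the powers of `y`, by skew-symmetry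
(`rep_coexp`). Surjectivity is an induction on the degree (`coexp_bijective`). This does not use
the Poincaré-Birkhoff-Witt theorem.

*Commutators and coproduct.* Under symmetrization left multiplication with `x̂_α` becomes
`repOp α`. So the commutator of `P(∂̂)` with `x̂_α` is `Q(∂̂)`, where `Q` is the image of `P`
under the vector field above (`hat_commutator`). For an element `u = X ^ N`, where `X` is in the Lie
algebra, the identity `T X^N = ∑ w, C(N, w) X^(N - w) [[…[T, X], …], X]`
(`mul_pow_eq_sum_commutator`) with `T = ∂̂^μ` is the deformed Leibniz rule, with the coproduct as a
sum over iterated commutators; such powers span the enveloping algebra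
(`isDeformedCoproduct_coproduct`). The series `coproduct` is well defined since the summand with `w`
commutators is homogeneous of degree `w` in the left variables. It is unique because a nonzero
element of the completed tensor square maps the pair of monomials which belongs to a nonzero
coefficient of minimal degree to a nonzero multiple of `1 ⊗ 1` (`eq_zero_of_mul'_hat₂_eq_zero`).

*Trees.* The components of `φ` of degree `s` are the values of the white nodes with `s` children
(`coeff_fieldMatrix`). By Leibniz' rule the corresponding vector field replaces one black
leaf of a tree by a white node with `s` black children (`nodeDeriv_ev`). Every ordered tree arises
in exactly one way by successively grafting the nodes `1, …, w`, since the node with the largest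
number has only black children (`PlanarTree.sum_orderedTrees_cons`). So the iterated commutators are
the sums over ordered trees (`coeff_nestedSeries`).
-/

namespace SymOrd

noncomputable section

/-! ### Differential operators and divided powers -/

section DividedPowers

variable {k : Type*} [Field k] {n : ℕ}

/-- The divided power `x^a / a!`. -/
def dpow (k : Type*) [Field k] {n : ℕ} (a : Fin n →₀ ℕ) : MvPolynomial (Fin n) k :=
  MvPolynomial.monomial a ((∏ i, (a i)! : ℕ) : k)⁻¹

variable [CharZero k]

lemma prod_factorial_ne_zero (a : Fin n →₀ ℕ) : ((∏ i, (a i)! : ℕ) : k) ≠ 0 :=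
  Nat.cast_ne_zero.2 (Finset.prod_ne_zero_iff.2 fun _ _ => Nat.factorial_ne_zero _)

lemma monomial_eq_smul_dpow (a : Fin n →₀ ℕ) (c : k) :
    MvPolynomial.monomial a c = (c * ((∏ i, (a i)! : ℕ) : k)) • dpow k a := by
  rw [dpow, MvPolynomial.smul_monomial, smul_eq_mul, mul_assoc,
    mul_inv_cancel₀ (prod_factorial_ne_zero a), mul_one]

lemma linearMap_ext_dpow {V : Type*} [AddCommGroup V] [Module k V]
    {S T : MvPolynomial (Fin n) k →ₗ[k] V} (h : ∀ a, S (dpow k a) = T (dpow k a)) : S = T := by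
  refine (MvPolynomial.basisMonomials (Fin n) k).ext fun a => ?_
  rw [MvPolynomial.coe_basisMonomials]
  beta_reduce
  rw [monomial_eq_smul_dpow, map_smul, map_smul, h]

omit [CharZero k] in
lemma diffOp_monomial (P : MvPowerSeries (Fin n) k) (a : Fin n →₀ ℕ) :
    diffOp P (MvPolynomial.monomial a 1) =
      ∑ p ∈ Finset.HasAntidiagonal.antidiagonal a, MvPolynomial.monomial p.2
        (MvPowerSeries.coeff p.1 P * ((∏ i, (a i).descFactorial (p.1 i) : ℕ) : k)) := by
  have h : MvPolynomial.monomial a (1 : k) = MvPolynomial.basisMonomials (Fin n) k a := by simp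
  rw [diffOp, h, Module.Basis.constr_basis]

/-- In terms of divided powers, differential operators act by convolution. -/
lemma diffOp_dpow (P : MvPowerSeries (Fin n) k) (a : Fin n →₀ ℕ) :
    diffOp P (dpow k a) =
      ∑ p ∈ Finset.HasAntidiagonal.antidiagonal a, MvPowerSeries.coeff p.1 P • dpow k p.2 := by
  have h : dpow k a = ((∏ i, (a i)! : ℕ) : k)⁻¹ • MvPolynomial.monomial a (1 : k) := by
    rw [MvPolynomial.smul_monomial, smul_eq_mul, mul_one, dpow]
  rw [h, map_smul, diffOp_monomial, Finset.smul_sum]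
  refine Finset.sum_congr rfl fun p hp => ?_
  rw [Finset.HasAntidiagonal.mem_antidiagonal] at hp
  rw [monomial_eq_smul_dpow, smul_smul]
  congr 1
  have h2 : (∏ i, (a i).descFactorial (p.1 i)) * ∏ i, (p.2 i)! = ∏ i, (a i)! := by
    rw [← Finset.prod_mul_distrib]
    refine Finset.prod_congr rfl fun i _ => ?_
    have : a i = p.1 i + p.2 i := by rw [← hp]; rfl
    rw [this, mul_comm]
    convert Nat.factorial_mul_descFactorial (Nat.le_add_right (p.1 i) (p.2 i)) using 3
    simp
  rw [mul_assoc, ← Nat.cast_mul, h2, mul_left_comm,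
    inv_mul_cancel₀ (prod_factorial_ne_zero a), mul_one]

lemma sum_antidiagonal_add_single {M : Type*} [AddCommMonoid M] (a : Fin n →₀ ℕ) (i : Fin n)
    (F : (Fin n →₀ ℕ) → (Fin n →₀ ℕ) → M) :
    ∑ p ∈ Finset.HasAntidiagonal.antidiagonal (a + Finsupp.single i 1 : Fin n →₀ ℕ),
        p.1 i • F p.1 p.2 =
      ∑ p ∈ Finset.HasAntidiagonal.antidiagonal a,
        (p.1 i + 1) • F (p.1 + Finsupp.single i 1) p.2 := by
  symm
  refine Finset.sum_bij_ne_zero (fun p _ _ => (p.1 + Finsupp.single i 1, p.2)) ?_ ?_ ?_ ?_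
  · intro p hp _
    rw [Finset.HasAntidiagonal.mem_antidiagonal] at hp ⊢
    rw [← hp]; simp only; abel
  · intro p _ _ q _ _ h
    simp only [Prod.mk.injEq, add_left_inj] at h
    exact Prod.ext h.1 h.2
  · intro p hp h0
    have h1 : p.1 i ≠ 0 := fun h => h0 (by rw [h, zero_smul])
    have hle : Finsupp.single i 1 ≤ p.1 := by
      rw [Finsupp.single_le_iff]; omega
    refine ⟨(p.1 - Finsupp.single i 1, p.2), ?_, ?_, ?_⟩
    · rw [Finset.HasAntidiagonal.mem_antidiagonal] at hp ⊢
      have := tsub_add_cancel_of_le hle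
      apply add_right_cancel (b := Finsupp.single i 1)
      rw [← hp, add_right_comm, this]
    · simp only [tsub_add_cancel_of_le hle]
      convert h0 using 2
      simp; omega
    · simp only [tsub_add_cancel_of_le hle]
  · intro p _ _
    simp

lemma X_mul_dpow (i : Fin n) (a : Fin n →₀ ℕ) :
    MvPolynomial.X i * dpow k a = (a i + 1) • dpow k (a + Finsupp.single i 1) := by
  have h : (∏ j, ((a + Finsupp.single i 1 : Fin n →₀ ℕ) j)!) = (a i + 1) * ∏ j, (a j)! := by
    rw [← Finset.mul_prod_erase _ _ (Finset.mem_univ i),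
      ← Finset.mul_prod_erase _ (fun j => (a j)!) (Finset.mem_univ i), ← mul_assoc]
    congr 1
    · simp [Nat.factorial_succ]
    · refine Finset.prod_congr rfl fun j hj => ?_
      simp [(Finset.ne_of_mem_erase hj)]
  rw [dpow, dpow, MvPolynomial.X, MvPolynomial.monomial_mul, add_comm, one_mul, h,
    ← Nat.cast_smul_eq_nsmul k, MvPolynomial.smul_monomial]
  congr 1
  have := prod_factorial_ne_zero (k := k) a
  have h3 : ((a i : k) + 1) ≠ 0 := by exact_mod_cast Nat.succ_ne_zero (a i)
  push_cast at *
  rw [smul_eq_mul, mul_inv, ← mul_assoc, mul_inv_cancel₀ h3, one_mul]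

lemma diffOp_one : diffOp (1 : MvPowerSeries (Fin n) k) = 1 := by
  classical
  refine linearMap_ext_dpow fun a => ?_
  rw [diffOp_dpow, Finset.sum_eq_single (0, a)]
  · simp
  · rintro ⟨p, q⟩ hp h
    rw [Finset.HasAntidiagonal.mem_antidiagonal] at hp
    rw [MvPowerSeries.coeff_one, if_neg, zero_smul]
    rintro rfl
    simp at hp
    simp [hp] at h
  · simp

lemma diffOp_mul (P Q : MvPowerSeries (Fin n) k) : diffOp (P * Q) = diffOp P * diffOp Q := by
  classical
  refine linearMap_ext_dpow fun a => ?_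
  rw [mul_comm, Module.End.mul_apply, diffOp_dpow, diffOp_dpow, map_sum]
  simp only [MvPowerSeries.coeff_mul, map_smul, diffOp_dpow, Finset.sum_smul, Finset.smul_sum,
    Finset.sum_sigma', smul_smul]
  refine Finset.sum_nbij' (fun x => ⟨(x.2.1, x.2.2 + x.1.2), (x.2.2, x.1.2)⟩)
    (fun x => ⟨(x.1.1 + x.2.1, x.2.2), (x.1.1, x.2.1)⟩) ?_ ?_ ?_ ?_ ?_
  · rintro ⟨⟨p, q⟩, ⟨r, s⟩⟩ h
    simp only [Finset.mem_sigma, Finset.HasAntidiagonal.mem_antidiagonal] at h ⊢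
    obtain ⟨rfl, rfl⟩ := h
    simp [add_assoc]
  · rintro ⟨⟨p, q⟩, ⟨r, s⟩⟩ h
    simp only [Finset.mem_sigma, Finset.HasAntidiagonal.mem_antidiagonal] at h ⊢
    obtain ⟨rfl, rfl⟩ := h
    simp [add_assoc]
  · rintro ⟨⟨p, q⟩, ⟨r, s⟩⟩ h
    simp only [Finset.mem_sigma, Finset.HasAntidiagonal.mem_antidiagonal] at h ⊢
    obtain ⟨rfl, rfl⟩ := h
    rfl
  · rintro ⟨⟨p, q⟩, ⟨r, s⟩⟩ h
    simp only [Finset.mem_sigma, Finset.HasAntidiagonal.mem_antidiagonal] at h ⊢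
    obtain ⟨rfl, rfl⟩ := h
    rfl
  · rintro ⟨⟨p, q⟩, ⟨r, s⟩⟩ h
    rfl

/-- Formal power series in the derivatives, acting on polynomials, as an algebra homomorphism. -/
def diffOpHom (k : Type*) [Field k] [CharZero k] (n : ℕ) :
    MvPowerSeries (Fin n) k →ₐ[k] Module.End k (MvPolynomial (Fin n) k) :=
  AlgHom.ofLinearMap
    { toFun := diffOp
      map_add' := fun P Q => linearMap_ext_dpow fun a => by
        simp [diffOp_dpow, add_smul, Finset.sum_add_distrib]
      map_smul' := fun c P => linearMap_ext_dpow fun a => by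
        simp [diffOp_dpow, Finset.smul_sum, smul_smul] }
    diffOp_one diffOp_mul

@[simp]
lemma diffOpHom_apply (P : MvPowerSeries (Fin n) k) : diffOpHom k n P = diffOp P := rfl

lemma diffOp_X (μ : Fin n) :
    diffOp (MvPowerSeries.X μ : MvPowerSeries (Fin n) k) =
      (MvPolynomial.pderiv μ).toLinearMap := by
  classical
  refine linearMap_ext_dpow fun a => ?_
  simp only [diffOp_dpow, MvPowerSeries.coeff_X, ite_smul, one_smul, zero_smul]
  have hf : (Finset.HasAntidiagonal.antidiagonal a).filter
      (fun x => x.1 = Finsupp.single μ 1) = if Finsupp.single μ 1 ≤ a then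
        {(Finsupp.single μ 1, a - Finsupp.single μ 1)} else ∅ := by
    convert Finset.HasAntidiagonal.filter_fst_eq_antidiagonal a (Finsupp.single μ 1)
  rw [← Finset.sum_filter, hf]
  split_ifs with h
  · obtain ⟨c, rfl⟩ := exists_add_of_le h
    rw [Finset.sum_singleton, add_tsub_cancel_left, add_comm]
    have h1 : ((c μ + 1 : ℕ) : k) ≠ 0 := Nat.cast_ne_zero.2 (Nat.succ_ne_zero _)
    have h2 := X_mul_dpow (k := k) μ c
    rw [← Nat.cast_smul_eq_nsmul k] at h2
    rw [← inv_smul_eq_iff₀ h1] at h2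
    rw [← h2, map_smul, eq_inv_smul_iff₀ h1]
    simp only [Derivation.coeFn_coe, Derivation.leibniz,
      MvPolynomial.pderiv_X_self, smul_eq_mul, mul_one]
    rw [dpow, MvPolynomial.pderiv_monomial]
    by_cases hc : c μ = 0
    · simp [hc]
    · rw [MvPolynomial.X, MvPolynomial.monomial_mul,
        add_tsub_cancel_of_le (by rw [Finsupp.single_le_iff]; omega), MvPolynomial.smul_monomial,
        ← map_add]
      congr 1
      simp; ring
  · rw [Finset.sum_empty]
    simp only [Derivation.coeFn_coe, dpow,
      MvPolynomial.pderiv_monomial]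
    have : a μ = 0 := by
      by_contra h0
      exact h (by rw [Finsupp.single_le_iff]; omega)
    simp [this]

/-- The commutator of `P(∂)` with multiplication by `x_i` is `(∂P/∂∂^i)(∂)`. -/
lemma diffOp_X_mul (P : MvPowerSeries (Fin n) k) (i : Fin n) :
    diffOp P * LinearMap.mulLeft k (MvPolynomial.X i) =
      LinearMap.mulLeft k (MvPolynomial.X i) * diffOp P +
        diffOp (MvPowerSeries.pderiv k i P) := by
  refine linearMap_ext_dpow fun a => ?_
  rw [Module.End.mul_apply, LinearMap.mulLeft_apply, X_mul_dpow, map_nsmul, diffOp_dpow,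
    LinearMap.add_apply, Module.End.mul_apply, diffOp_dpow, diffOp_dpow, map_sum,
    Finset.smul_sum]
  have h1 : ∀ p ∈ Finset.HasAntidiagonal.antidiagonal (a + Finsupp.single i 1),
      (a i + 1) • MvPowerSeries.coeff p.1 P • dpow k p.2 =
      p.1 i • MvPowerSeries.coeff p.1 P • dpow k p.2 +
      p.2 i • MvPowerSeries.coeff p.1 P • dpow k p.2 := by
    intro p hp
    rw [Finset.HasAntidiagonal.mem_antidiagonal] at hp
    have : a i + 1 = p.1 i + p.2 i := by rw [← Finsupp.add_apply, hp]; simp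
    rw [this, add_smul]
  rw [Finset.sum_congr rfl h1, Finset.sum_add_distrib,
    sum_antidiagonal_add_single a i (fun p q => MvPowerSeries.coeff p P • dpow k q),
    Finsupp.sum_antidiagonal_swap (a + Finsupp.single i 1)
      (fun p q => q i • MvPowerSeries.coeff p P • dpow k q),
    sum_antidiagonal_add_single a i (fun q p => MvPowerSeries.coeff p P • dpow k q), add_comm]
  congr 1
  · rw [← Finsupp.sum_antidiagonal_swap a
      (fun p q => (q i + 1) • MvPowerSeries.coeff p P • dpow k (q + Finsupp.single i 1))]
    refine Finset.sum_congr rfl fun p _ => ?_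
    simp only [map_smul, LinearMap.mulLeft_apply, X_mul_dpow]
    rw [smul_comm]
  · refine Finset.sum_congr rfl fun p _ => ?_
    rw [MvPowerSeries.coeff_pderiv, ← Nat.cast_smul_eq_nsmul k, smul_smul]
    push_cast
    rw [mul_comm]

end DividedPowers

/-! ### Power series in a matrix of linear forms -/

section MatrixSeries

variable {k : Type*} [Field k] {n : ℕ}

/-- Substitution of a matrix `A` whose entries are linear forms in a power series `F`. Since the
entries of `A ^ s` are homogeneous of degree `s`, the coefficient of degree `d` only depends on the
term `F_d A ^ d`. -/
def evalSeries (A : Matrix (Fin n) (Fin n) (MvPowerSeries (Fin n) k)) (F : PowerSeries k) :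
    Matrix (Fin n) (Fin n) (MvPowerSeries (Fin n) k) :=
  fun i j m => PowerSeries.coeff m.degree F * MvPowerSeries.coeff m ((A ^ m.degree) i j)

variable {A : Matrix (Fin n) (Fin n) (MvPowerSeries (Fin n) k)}

lemma coeff_evalSeries (F : PowerSeries k) (i j : Fin n) (m : Fin n →₀ ℕ) :
    MvPowerSeries.coeff m (evalSeries A F i j) =
      PowerSeries.coeff m.degree F * MvPowerSeries.coeff m ((A ^ m.degree) i j) := rfl

/-- The entries of a matrix are linear forms. -/
def IsLinearMatrix (A : Matrix (Fin n) (Fin n) (MvPowerSeries (Fin n) k)) : Prop :=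
  ∀ i j m, m.degree ≠ 1 → MvPowerSeries.coeff m (A i j) = 0

lemma IsLinearMatrix.coeff_pow (hA : IsLinearMatrix A) (s : ℕ) :
    ∀ i j m, m.degree ≠ s → MvPowerSeries.coeff m ((A ^ s) i j) = 0 := by
  classical
  induction s with
  | zero =>
    intro i j m hm
    rw [pow_zero, Matrix.one_apply]
    split_ifs
    · rw [MvPowerSeries.coeff_one, if_neg]
      rintro rfl
      simp at hm
    · simp
  | succ s ih =>
    intro i j m hm
    rw [pow_succ, Matrix.mul_apply, map_sum]
    refine Finset.sum_eq_zero fun l _ => ?_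
    rw [MvPowerSeries.coeff_mul]
    refine Finset.sum_eq_zero fun p hp => ?_
    rw [Finset.HasAntidiagonal.mem_antidiagonal] at hp
    by_cases h1 : p.1.degree = s
    · rw [hA _ _ p.2, mul_zero]
      intro h2
      rw [← hp, map_add, h1, h2] at hm
      exact hm rfl
    · rw [ih _ _ _ h1, zero_mul]

/-- Substitution is multiplicative, although `evalSeries` is defined degree by degree: products of
the components of degrees `s` and `s'` have degree `s + s'`. -/
lemma evalSeries_mul (hA : IsLinearMatrix A) (F G : PowerSeries k) :
    evalSeries A (F * G) = evalSeries A F * evalSeries A G := by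
  classical
  ext i j m
  rw [coeff_evalSeries, Matrix.mul_apply, map_sum, PowerSeries.coeff_mul, Finset.sum_mul]
  simp only [MvPowerSeries.coeff_mul, coeff_evalSeries]
  have h : ∀ x ∈ Finset.HasAntidiagonal.antidiagonal m.degree,
      PowerSeries.coeff x.1 F * PowerSeries.coeff x.2 G *
        MvPowerSeries.coeff m ((A ^ m.degree) i j) =
      ∑ p ∈ Finset.HasAntidiagonal.antidiagonal m, if p.1.degree = x.1 then ∑ l,
        PowerSeries.coeff p.1.degree F * MvPowerSeries.coeff p.1 ((A ^ p.1.degree) i l) *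
        (PowerSeries.coeff p.2.degree G * MvPowerSeries.coeff p.2 ((A ^ p.2.degree) l j))
        else 0 := by
    intro x hx
    rw [Finset.HasAntidiagonal.mem_antidiagonal] at hx
    rw [← hx, pow_add, Matrix.mul_apply, map_sum, Finset.mul_sum]
    simp only [MvPowerSeries.coeff_mul, Finset.mul_sum]
    rw [Finset.sum_comm]
    refine Finset.sum_congr rfl fun p hp => ?_
    rw [Finset.HasAntidiagonal.mem_antidiagonal] at hp
    split_ifs with h
    · have h2 : p.2.degree = x.2 := by
        rw [← hp, map_add] at hx
        omega
      rw [h, h2]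
      exact Finset.sum_congr rfl fun l _ => by ring
    · exact Finset.sum_eq_zero fun l _ => by rw [hA.coeff_pow _ _ _ _ h]; ring
  rw [Finset.sum_congr rfl h, Finset.sum_comm, Finset.sum_comm (s := Finset.univ)]
  refine Finset.sum_congr rfl fun p hp => ?_
  rw [Finset.HasAntidiagonal.mem_antidiagonal] at hp
  rw [Finset.sum_eq_single (p.1.degree, p.2.degree)]
  · simp
  · rintro ⟨x, y⟩ hx hne
    rw [if_neg]
    rintro rfl
    rw [Finset.HasAntidiagonal.mem_antidiagonal, ← hp, map_add] at hx
    simp only [add_right_inj] at hx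
    exact hne (by rw [hx])
  · intro h
    exact absurd (by rw [Finset.HasAntidiagonal.mem_antidiagonal, ← hp, map_add]) h

lemma evalSeries_one : evalSeries A 1 = 1 := by
  classical
  ext i j m
  rw [coeff_evalSeries, PowerSeries.coeff_one]
  split_ifs with h
  · rw [h, pow_zero, one_mul]
  · rw [Matrix.one_apply]
    split_ifs
    · rw [MvPowerSeries.coeff_one, if_neg (fun h0 => h (by simp [h0])), zero_mul]
    · simp

lemma evalSeries_add (F G : PowerSeries k) :
    evalSeries A (F + G) = evalSeries A F + evalSeries A G := by
  ext i j m
  rw [coeff_evalSeries, Matrix.add_apply, map_add, map_add, add_mul]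
  rfl

lemma evalSeries_X (hA : IsLinearMatrix A) : evalSeries A PowerSeries.X = A := by
  ext i j m
  rw [coeff_evalSeries, PowerSeries.coeff_X]
  split_ifs with h
  · rw [h, pow_one, one_mul]
  · rw [hA _ _ _ h, zero_mul]

end MatrixSeries

/-! ### The Maurer-Cartan equation -/

section MaurerCartan

variable {k : Type*} [Field k] {n : ℕ}

/-- The Euler derivation `∑ ρ, ∂^ρ ∂/∂∂^ρ`. -/
def euler (k : Type*) [Field k] (n : ℕ) :
    Derivation k (MvPowerSeries (Fin n) k) (MvPowerSeries (Fin n) k) :=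
  ∑ ρ, (MvPowerSeries.X ρ : MvPowerSeries (Fin n) k) • MvPowerSeries.pderiv k ρ

lemma coeff_X_mul_pderiv (f : MvPowerSeries (Fin n) k) (ρ : Fin n) (m : Fin n →₀ ℕ) :
    MvPowerSeries.coeff m (MvPowerSeries.X ρ * MvPowerSeries.pderiv k ρ f) =
      m ρ * MvPowerSeries.coeff m f := by
  classical
  rw [MvPowerSeries.X, MvPowerSeries.coeff_monomial_mul]
  split_ifs with h
  · rw [MvPowerSeries.coeff_pderiv, tsub_add_cancel_of_le h, one_mul, mul_comm]
    congr 1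
    rw [Finsupp.single_le_iff] at h
    rw [Finsupp.tsub_apply, Finsupp.single_eq_same, Nat.cast_sub h]
    simp
  · rw [Finsupp.single_le_iff] at h
    have : m ρ = 0 := by omega
    simp [this]

lemma coeff_euler (f : MvPowerSeries (Fin n) k) (m : Fin n →₀ ℕ) :
    MvPowerSeries.coeff m (euler k n f) = m.degree * MvPowerSeries.coeff m f := by
  have : euler k n f = ∑ ρ, MvPowerSeries.X ρ * MvPowerSeries.pderiv k ρ f := by
    rw [euler, ← Derivation.coeFnAddMonoidHom_apply, map_sum, Finset.sum_apply]
    rfl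
  rw [this, map_sum, Finsupp.degree_eq_sum, Nat.cast_sum, Finset.sum_mul]
  exact Finset.sum_congr rfl fun ρ _ => coeff_X_mul_pderiv f ρ m

lemma euler_pderiv (f : MvPowerSeries (Fin n) k) (i : Fin n) :
    euler k n (MvPowerSeries.pderiv k i f) =
      MvPowerSeries.pderiv k i (euler k n f) - MvPowerSeries.pderiv k i f := by
  ext m
  rw [map_sub, coeff_euler, MvPowerSeries.coeff_pderiv, MvPowerSeries.coeff_pderiv, coeff_euler,
    map_add, Finsupp.degree_single]
  push_cast
  ring

variable {M : Type*} [LieRing M] [LieAlgebra (MvPowerSeries (Fin n) k) M]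
  (e : Module.Basis (Fin n) (MvPowerSeries (Fin n) k) M)

/-- The action of a derivation of the scalars on the coordinates with respect to a basis. -/
def coordDeriv (D : Derivation k (MvPowerSeries (Fin n) k) (MvPowerSeries (Fin n) k)) : M →+ M where
  toFun u := ∑ l, D (e.repr u l) • e l
  map_zero' := by simp
  map_add' u v := by simp [add_smul, Finset.sum_add_distrib]

variable (D : Derivation k (MvPowerSeries (Fin n) k) (MvPowerSeries (Fin n) k))

lemma coordDeriv_apply (u : M) : coordDeriv e D u = ∑ l, D (e.repr u l) • e l := rfl

lemma repr_coordDeriv (u : M) (l : Fin n) :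
    e.repr (coordDeriv e D u) l = D (e.repr u l) := by
  rw [coordDeriv_apply, e.repr_sum_self]

lemma coordDeriv_smul (r : MvPowerSeries (Fin n) k) (u : M) :
    coordDeriv e D (r • u) = D r • u + r • coordDeriv e D u := by
  apply e.ext_elem
  intro l
  simp only [repr_coordDeriv, map_smul, map_add, Finsupp.smul_apply, Finsupp.add_apply,
    smul_eq_mul, Derivation.leibniz]
  ring

@[simp]
lemma coordDeriv_basis (j : Fin n) : coordDeriv e D (e j) = 0 := by
  classical
  rw [coordDeriv_apply]
  refine Finset.sum_eq_zero fun l _ => ?_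
  rw [e.repr_self, Finsupp.single_apply]
  split_ifs <;> simp

/-- The structure constants of a basis lie in the field `k`. -/
def HasStructConst (c : Fin n → Fin n → Fin n → k) : Prop :=
  ∀ i j, ⁅e i, e j⁆ = ∑ l, (MvPowerSeries.C (c l i j) : MvPowerSeries (Fin n) k) • e l

variable {e} {c : Fin n → Fin n → Fin n → k}

/-- Since the structure constants are scalars, a derivation of the coordinates is a derivation of
the Lie bracket. -/
lemma coordDeriv_lie (hc : HasStructConst e c) (u v : M) :
    coordDeriv e D ⁅u, v⁆ = ⁅coordDeriv e D u, v⁆ + ⁅u, coordDeriv e D v⁆ := by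
  have h0 : ∀ i j, coordDeriv e D ⁅e i, e j⁆ = 0 := fun i j => by
    simp [hc i j, coordDeriv_smul, MvPowerSeries.c_eq_algebraMap]
  conv_lhs => rw [← e.sum_repr u, ← e.sum_repr v]
  rw [coordDeriv_apply e D u, coordDeriv_apply e D v]
  conv_rhs =>
    congr
    · rw [← e.sum_repr v]
    · rw [← e.sum_repr u]
  simp only [sum_lie, lie_sum, smul_lie, lie_smul, map_sum, coordDeriv_smul, h0, smul_zero,
    add_zero, Finset.sum_add_distrib]
  rw [add_comm]

lemma coordDeriv_euler_pderiv (i : Fin n) (u : M) :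
    coordDeriv e (euler k n) (coordDeriv e (MvPowerSeries.pderiv k i) u) =
      coordDeriv e (MvPowerSeries.pderiv k i) (coordDeriv e (euler k n) u) -
        coordDeriv e (MvPowerSeries.pderiv k i) u := by
  apply e.ext_elem
  intro l
  simp only [map_sub, Finsupp.sub_apply, repr_coordDeriv, euler_pderiv]

/-- The matrix `A` of `ad X` for the generic element `X = ∑ ρ, ∂^ρ e_ρ`, in the convention
`⁅X, e_a⁆ = ∑ l, A a l e_l`, with `c l i j` standing for `C^l_{i j}`. Its entries are linear
forms. -/
def adMatrix (c : Fin n → Fin n → Fin n → k) : Matrix (Fin n) (Fin n) (MvPowerSeries (Fin n) k) :=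
  fun a l => ∑ ρ, MvPowerSeries.C (c l ρ a) * MvPowerSeries.X ρ

lemma isLinearMatrix_adMatrix : IsLinearMatrix (adMatrix c) := by
  classical
  intro a l m hm
  rw [adMatrix, map_sum]
  refine Finset.sum_eq_zero fun ρ _ => ?_
  rw [MvPowerSeries.coeff_C_mul, MvPowerSeries.coeff_X, if_neg, mul_zero]
  rintro rfl
  simp at hm

variable (e) in
/-- The generic element `∑ ρ, ∂^ρ e_ρ`. -/
def genericElt : M := ∑ ρ, (MvPowerSeries.X ρ : MvPowerSeries (Fin n) k) • e ρ

lemma genericElt_lie_basis (hc : HasStructConst e c) (a : Fin n) :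
    ⁅genericElt e, e a⁆ = ∑ l, adMatrix c a l • e l := by
  simp only [genericElt, sum_lie, smul_lie, hc _ a, Finset.smul_sum, adMatrix,
    Finset.sum_smul, smul_smul]
  rw [Finset.sum_comm]
  simp only [mul_comm]

variable [CharZero k]

/-- The equation `E u + 2 u = ⁅X, u⁆` for the Euler derivation `E` has only the solution `0`: the
component of degree `d` of `u` is determined by the one of degree `d - 1`, because `d + 2 ≠ 0`. -/
lemma euler_homogeneous_unique (hc : HasStructConst e c) {u : M}
    (hu : coordDeriv e (euler k n) u + (2 : ℕ) • u = ⁅genericElt e, u⁆) : u = 0 := by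
  classical
  have key : ∀ (d : ℕ) (m : Fin n →₀ ℕ), m.degree = d →
      ∀ l, MvPowerSeries.coeff m (e.repr u l) = 0 := by
    intro d
    induction d using Nat.strong_induction_on with
    | _ d ih =>
    intro m hm l
    have h1 : euler k n (e.repr u l) + (2 : ℕ) • e.repr u l =
        ∑ j, e.repr u j * adMatrix c j l := by
      have h2 : ⁅genericElt e, u⁆ = ∑ l, (∑ j, e.repr u j * adMatrix c j l) • e l := by
        conv_lhs => rw [← e.sum_repr u]
        simp only [lie_sum, lie_smul, genericElt_lie_basis hc, Finset.smul_sum, Finset.sum_smul,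
          smul_smul]
        exact Finset.sum_comm
      have h3 := congrArg (fun v => e.repr v l) hu
      simp only [map_add, map_nsmul, Finsupp.add_apply, Finsupp.smul_apply, repr_coordDeriv] at h3
      rw [h3, h2, e.repr_sum_self]
    have h2 := congrArg (MvPowerSeries.coeff m) h1
    rw [map_add, map_nsmul, coeff_euler, map_sum, Finset.sum_eq_zero, hm] at h2
    · have h3 : ((d + 2 : ℕ) : k) ≠ 0 := Nat.cast_ne_zero.2 (by omega)
      rw [nsmul_eq_mul, ← add_mul] at h2
      exact (mul_eq_zero.1 h2).resolve_left (by exact_mod_cast h3)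
    · intro j _
      rw [MvPowerSeries.coeff_mul]
      refine Finset.sum_eq_zero fun p hp => ?_
      rw [Finset.HasAntidiagonal.mem_antidiagonal] at hp
      by_cases hq : p.2.degree = 1
      · have : p.1.degree + p.2.degree = d := by rw [← map_add, hp, hm]
        rw [ih p.1.degree (by omega) p.1 rfl, zero_mul]
      · rw [isLinearMatrix_adMatrix _ _ _ hq, mul_zero]
  apply e.ext_elem
  intro l
  ext m
  simpa using key _ m rfl l

/-- The power series `(e^t - 1) / t`. -/
def expQuotient (k : Type*) [Field k] : PowerSeries k :=
  PowerSeries.mk fun s => (((s + 1)! : ℕ) : k)⁻¹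

/-- The power series `t / (e^t - 1)`, the generating function of the Bernoulli numbers. -/
def bernoulliSeries (k : Type*) [Field k] : PowerSeries k :=
  PowerSeries.mk fun s => (bernoulli s : k) / (s ! : ℕ)

lemma X_mul_expQuotient : PowerSeries.X * expQuotient k = PowerSeries.exp k - 1 := by
  ext s
  cases s with
  | zero => simp
  | succ s => simp [PowerSeries.coeff_succ_X_mul, expQuotient, PowerSeries.coeff_exp,
      PowerSeries.coeff_one]

lemma bernoulliSeries_mul_expQuotient : bernoulliSeries k * expQuotient k = 1 := by
  have h := bernoulliPowerSeries_mul_exp_sub_one k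
  have h1 : bernoulliPowerSeries k = bernoulliSeries k := by
    ext s
    simp [bernoulliPowerSeries, bernoulliSeries]
  rw [← X_mul_expQuotient, h1, mul_left_comm] at h
  exact mul_left_cancel₀ PowerSeries.X_ne_zero (h.trans (mul_one _).symm)

/-- The matrix `(e^A - 1) / A` for `A = ad X`: its rows are the values at the basis vectors of
the Maurer-Cartan form in exponential coordinates. -/
def mcMatrix (c : Fin n → Fin n → Fin n → k) : Matrix (Fin n) (Fin n) (MvPowerSeries (Fin n) k) :=
  evalSeries (adMatrix c) (expQuotient k)

/-- The matrix `A / (e^A - 1)` for `A = ad X`: its rows are the coordinates of invariant vector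
fields in exponential coordinates. -/
def fieldMatrix (c : Fin n → Fin n → Fin n → k) :
    Matrix (Fin n) (Fin n) (MvPowerSeries (Fin n) k) :=
  evalSeries (adMatrix c) (bernoulliSeries k)

lemma fieldMatrix_mul_mcMatrix : fieldMatrix c * mcMatrix c = 1 := by
  rw [fieldMatrix, mcMatrix, ← evalSeries_mul isLinearMatrix_adMatrix,
    bernoulliSeries_mul_expQuotient, evalSeries_one]

lemma mcMatrix_mul_fieldMatrix : mcMatrix c * fieldMatrix c = 1 := by
  rw [fieldMatrix, mcMatrix, ← evalSeries_mul isLinearMatrix_adMatrix, mul_comm,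
    bernoulliSeries_mul_expQuotient, evalSeries_one]

/-- The differential equation `t Q' + Q = e^t = 1 + t Q` of `Q = (e^t - 1) / t`, for the argument
`A = ad X`. -/
lemma euler_mcMatrix (j l : Fin n) :
    euler k n (mcMatrix c j l) + mcMatrix c j l =
      (1 : Matrix (Fin n) (Fin n) (MvPowerSeries (Fin n) k)) j l +
        (mcMatrix c * adMatrix c) j l := by
  have h : evalSeries (adMatrix c) (1 + expQuotient k * PowerSeries.X) =
      1 + mcMatrix c * adMatrix c := by
    rw [evalSeries_add, evalSeries_one, evalSeries_mul isLinearMatrix_adMatrix,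
      evalSeries_X isLinearMatrix_adMatrix, mcMatrix]
  rw [← Matrix.add_apply, ← h]
  ext m
  rw [map_add, coeff_euler, mcMatrix, coeff_evalSeries, coeff_evalSeries, mul_comm (expQuotient k),
    X_mul_expQuotient, add_sub_cancel, PowerSeries.coeff_exp, expQuotient, PowerSeries.coeff_mk]
  have h1 : ((m.degree + 1 : ℕ) : k) ≠ 0 := Nat.cast_ne_zero.2 (Nat.succ_ne_zero _)
  have h2 : ((m.degree ! : ℕ) : k) ≠ 0 := Nat.cast_ne_zero.2 (Nat.factorial_ne_zero _)
  have h3 : (m.degree : k) * (((m.degree + 1)! : ℕ) : k)⁻¹ + (((m.degree + 1)! : ℕ) : k)⁻¹ =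
      algebraMap ℚ k (1 / (m.degree ! : ℕ)) := by
    rw [Nat.factorial_succ]
    simp only [map_div₀, map_one, map_natCast]
    push_cast at *
    field_simp
  rw [← h3, add_mul, mul_assoc]

variable (e c) in
/-- The Maurer-Cartan form in the direction `e_j`. -/
def mcForm (j : Fin n) : M := ∑ l, mcMatrix c j l • e l

lemma euler_mcForm (hc : HasStructConst e c) (j : Fin n) :
    coordDeriv e (euler k n) (mcForm e c j) =
      e j + ⁅genericElt e, mcForm e c j⁆ - mcForm e c j := by
  rw [eq_sub_iff_add_eq]
  apply e.ext_elem
  intro l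
  have h2 : ⁅genericElt e, mcForm e c j⁆ = ∑ l, (mcMatrix c * adMatrix c) j l • e l := by
    simp only [mcForm, lie_sum, lie_smul, genericElt_lie_basis hc, Finset.smul_sum, smul_smul,
      Matrix.mul_apply, Finset.sum_smul]
    exact Finset.sum_comm
  have h3 : e.repr (mcForm e c j) l = mcMatrix c j l := by rw [mcForm, e.repr_sum_self]
  rw [map_add, map_add, Finsupp.add_apply, Finsupp.add_apply, repr_coordDeriv, h3, h2,
    e.repr_sum_self, euler_mcMatrix, e.repr_self, Finsupp.single_apply, Matrix.one_apply]

/-- The Maurer-Cartan equation: both sides solve the same linear equation for the Euler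
derivation, which has no nonzero solution. -/
lemma maurerCartan (hc : HasStructConst e c) (i j : Fin n) :
    coordDeriv e (MvPowerSeries.pderiv k i) (mcForm e c j) -
      coordDeriv e (MvPowerSeries.pderiv k j) (mcForm e c i) = ⁅mcForm e c i, mcForm e c j⁆ := by
  rw [← sub_eq_zero]
  apply euler_homogeneous_unique hc
  have hX : ∀ i, coordDeriv e (MvPowerSeries.pderiv k i) (genericElt e) = e i := by
    intro i
    simp only [genericElt, map_sum, coordDeriv_smul, coordDeriv_basis, smul_zero, add_zero]
    rw [Finset.sum_eq_single i]
    · rw [MvPowerSeries.pderiv_X_self, one_smul]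
    · intro j _ hj
      rw [MvPowerSeries.pderiv_X_of_ne hj, zero_smul]
    · simp
  simp only [map_sub, coordDeriv_euler_pderiv, coordDeriv_lie _ hc, euler_mcForm hc, map_add,
    coordDeriv_basis, hX, lie_sub, lie_add, sub_lie, add_lie]
  have hJ := leibniz_lie (genericElt e) (mcForm e c i) (mcForm e c j)
  have hs := lie_skew (mcForm e c i) (e j)
  rw [hJ, ← hs]
  abel

/-- The vectors `mcForm e c ρ` are linearly independent. -/
lemma mcForm_injective {u v : Fin n → MvPowerSeries (Fin n) k}
    (h : ∑ ρ, u ρ • mcForm e c ρ = ∑ ρ, v ρ • mcForm e c ρ) : u = v := by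
  have h1 : ∀ w : Fin n → MvPowerSeries (Fin n) k,
      ∑ ρ, w ρ • mcForm e c ρ = ∑ l, Matrix.vecMul w (mcMatrix c) l • e l := by
    intro w
    simp only [mcForm, Finset.smul_sum, smul_smul, Matrix.vecMul, dotProduct, Finset.sum_smul]
    exact Finset.sum_comm
  have h2 : Matrix.vecMul u (mcMatrix c) = Matrix.vecMul v (mcMatrix c) := by
    ext l : 1
    rw [h1, h1] at h
    simpa only [e.repr_sum_self] using congrArg (fun u => e.repr u l) h
  have h3 := congrArg (fun w => Matrix.vecMul w (fieldMatrix c)) h2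
  simpa only [Matrix.vecMul_vecMul, mcMatrix_mul_fieldMatrix,
    Matrix.vecMul_one] using h3

/-- The bracket of the vector fields given by the rows of `fieldMatrix`. They are the dual frame of
the Maurer-Cartan form, so this is equivalent to the Maurer-Cartan equation. -/
lemma fieldMatrix_bracket (hc : HasStructConst e c) (α β ρ : Fin n) :
    ∑ σ, (MvPowerSeries.pderiv k σ (fieldMatrix c α ρ) * fieldMatrix c β σ -
      MvPowerSeries.pderiv k σ (fieldMatrix c β ρ) * fieldMatrix c α σ) =
      ∑ l, MvPowerSeries.C (c l α β) * fieldMatrix c l ρ := by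
  have h1 : ∀ α, ∑ ρ, fieldMatrix c α ρ • mcForm e c ρ = e α := by
    intro α
    simp only [mcForm, Finset.smul_sum, smul_smul]
    rw [Finset.sum_comm]
    simp only [← Finset.sum_smul, ← Matrix.mul_apply, fieldMatrix_mul_mcMatrix]
    simp [Matrix.one_apply]
  have h2 : ∀ α β, ∑ ρ, (∑ σ, MvPowerSeries.pderiv k σ (fieldMatrix c α ρ) *
      fieldMatrix c β σ) • mcForm e c ρ = - ∑ σ, ∑ ρ, (fieldMatrix c β σ * fieldMatrix c α ρ) •
        coordDeriv e (MvPowerSeries.pderiv k σ) (mcForm e c ρ) := by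
    intro α β
    rw [eq_neg_iff_add_eq_zero]
    simp only [Finset.sum_smul]
    rw [Finset.sum_comm, ← Finset.sum_add_distrib]
    refine Finset.sum_eq_zero fun σ _ => ?_
    have := congrArg (coordDeriv e (MvPowerSeries.pderiv k σ)) (h1 α)
    rw [coordDeriv_basis, map_sum] at this
    simp only [coordDeriv_smul] at this
    rw [← Finset.sum_add_distrib, ← smul_zero (fieldMatrix c β σ), ← this, Finset.smul_sum]
    refine Finset.sum_congr rfl fun ρ _ => ?_
    rw [smul_add, smul_smul, smul_smul, mul_comm (fieldMatrix c β σ),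
      mul_comm (fieldMatrix c β σ)]
  have h3 : ∑ ρ, (∑ σ, (MvPowerSeries.pderiv k σ (fieldMatrix c α ρ) * fieldMatrix c β σ -
      MvPowerSeries.pderiv k σ (fieldMatrix c β ρ) * fieldMatrix c α σ)) • mcForm e c ρ =
      ∑ ρ, (∑ l, MvPowerSeries.C (c l α β) * fieldMatrix c l ρ) • mcForm e c ρ := by
    have h4 : ∑ ρ, (∑ l, MvPowerSeries.C (c l α β) * fieldMatrix c l ρ) • mcForm e c ρ =
        ⁅e α, e β⁆ := by
      rw [hc]
      simp only [Finset.sum_smul]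
      rw [Finset.sum_comm]
      refine Finset.sum_congr rfl fun l _ => ?_
      conv_rhs => rw [← h1 l]
      simp only [Finset.smul_sum, smul_smul]
    rw [h4, ← h1 α, ← h1 β]
    simp only [Finset.sum_sub_distrib, sub_smul]
    rw [h2 α β, h2 β α]
    conv_lhs =>
      congr
      · rw [Finset.sum_comm]
    simp only [sum_lie, lie_sum, smul_lie, lie_smul, ← maurerCartan hc, smul_sub,
      Finset.sum_sub_distrib]
    have h5 : ∀ x y x' y' : M, x' = x → y' = y → -x - -y = y' - x' := by
      rintro x y _ _ rfl rfl
      abel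
    refine h5 _ _ _ _ ?_ ?_
    · simp only [Finset.smul_sum, smul_smul]
      exact Finset.sum_comm
    · simp only [Finset.smul_sum, smul_smul]
      rw [Finset.sum_comm]
      exact Finset.sum_congr rfl fun σ _ => Finset.sum_congr rfl fun ρ _ => by rw [mul_comm]
  exact congrFun (mcForm_injective h3) ρ

end MaurerCartan

/-! ### Powers of linear forms and symmetrization -/

section Powers

variable {k : Type*} [Field k] {n : ℕ}

lemma sum_smul_pow {A : Type*} [Ring A] [Algebra k A] (c : Fin n → k) (x : Fin n → A) (N : ℕ) :
    (∑ i, c i • x i) ^ N =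
      ∑ f : Fin N → Fin n, (∏ i, c (f i)) • (List.ofFn fun i => x (f i)).prod := by
  induction N with
  | zero => simp
  | succ N ih =>
    rw [pow_succ', ih, ← (Fin.consEquiv fun _ => Fin n).sum_comp, Fintype.sum_prod_type,
      Finset.sum_mul]
    refine Finset.sum_congr rfl fun j _ => ?_
    rw [Finset.mul_sum]
    refine Finset.sum_congr rfl fun f _ => ?_
    simp [Fin.prod_univ_succ, List.ofFn_succ, Fin.consEquiv, smul_smul, mul_comm]

/-- The linear form `∑ i, c_i x_i`. -/
def linForm (c : Fin n → k) : MvPolynomial (Fin n) k := ∑ i, c i • MvPolynomial.X i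

lemma prod_X_eq_monomial {N : ℕ} (f : Fin N → Fin n) :
    ∏ i, (MvPolynomial.X (f i) : MvPolynomial (Fin n) k) =
      MvPolynomial.monomial (∑ i, Finsupp.single (f i) 1) 1 := by
  simp only [MvPolynomial.X]
  rw [MvPolynomial.monomial_sum_one]

lemma linForm_pow (c : Fin n → k) (N : ℕ) :
    linForm c ^ N = ∑ f : Fin N → Fin n, (∏ i, c (f i)) •
      (MvPolynomial.monomial (∑ i, Finsupp.single (f i) 1) (1 : k)) := by
  rw [linForm, sum_smul_pow]
  simp only [List.prod_ofFn, prod_X_eq_monomial]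

lemma exists_sum_single_eq (m : Fin n →₀ ℕ) :
    ∃ (N : ℕ) (f : Fin N → Fin n), ∑ i, Finsupp.single (f i) 1 = m := by
  induction m using Finsupp.induction_linear with
  | zero => exact ⟨0, Fin.elim0, by simp⟩
  | add a a' ha ha' =>
    obtain ⟨N, f, rfl⟩ := ha
    obtain ⟨N', f', rfl⟩ := ha'
    exact ⟨N + N', Fin.append f f', by simp [Fin.sum_univ_add]⟩
  | single i r => exact ⟨r, fun _ => i, by simp⟩

variable [CharZero k]

/-- In characteristic zero, the powers of linear forms span the polynomials. -/
lemma linearMap_ext_pow {V : Type*} [AddCommGroup V] [Module k V]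
    {S T : MvPolynomial (Fin n) k →ₗ[k] V}
    (h : ∀ c N, S (linForm c ^ N) = T (linForm c ^ N)) : S = T := by
  classical
  have hspan : Submodule.span k (Set.range fun p : (Fin n → k) × ℕ => linForm p.1 ^ p.2) = ⊤ := by
    by_contra hne
    obtain ⟨l, hl0, hl⟩ := Submodule.exists_le_ker_of_lt_top _ (lt_top_iff_ne_top.2 hne)
    refine hl0 ((MvPolynomial.basisMonomials (Fin n) k).ext fun m => ?_)
    obtain ⟨N, f₀, rfl⟩ := exists_sum_single_eq m
    set m : Fin n →₀ ℕ := ∑ i, Finsupp.single (f₀ i) 1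
    -- The value of `l` at the `N`-th power of a linear form, as a polynomial in its coefficients.
    have hp : (∑ f : Fin N → Fin n,
        l (MvPolynomial.monomial (∑ i, Finsupp.single (f i) 1) (1 : k)) •
          MvPolynomial.monomial (∑ i, Finsupp.single (f i) 1) (1 : k)) = 0 := by
      refine MvPolynomial.funext fun c => ?_
      have h1 : l (linForm c ^ N) = 0 := hl (Submodule.subset_span ⟨(c, N), rfl⟩)
      rw [linForm_pow, map_sum] at h1
      rw [map_zero, ← h1, map_sum]
      refine Finset.sum_congr rfl fun f _ => ?_
      rw [MvPolynomial.smul_eval, LinearMap.map_smul, smul_eq_mul, mul_comm,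
        ← prod_X_eq_monomial]
      simp
    have h2 := congrArg (MvPolynomial.coeff m) hp
    rw [MvPolynomial.coeff_sum, MvPolynomial.coeff_zero] at h2
    have h3 : ∀ f : Fin N → Fin n, MvPolynomial.coeff m
        (l (MvPolynomial.monomial (∑ i, Finsupp.single (f i) 1) (1 : k)) •
          MvPolynomial.monomial (∑ i, Finsupp.single (f i) 1) (1 : k)) =
        if ∑ i, Finsupp.single (f i) 1 = m then l (MvPolynomial.monomial m 1) else 0 := by
      intro f
      rw [MvPolynomial.coeff_smul, MvPolynomial.coeff_monomial]
      split_ifs with h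
      · rw [h, smul_eq_mul, mul_one]
      · simp
    simp only [h3] at h2
    rw [← Finset.sum_filter, Finset.sum_const, smul_eq_zero] at h2
    rcases h2 with h2 | h2
    · rw [Finset.card_eq_zero] at h2
      exact absurd rfl (Finset.filter_eq_empty_iff.1 h2 (Finset.mem_univ f₀))
    · simpa using h2
  refine LinearMap.ext_on hspan ?_
  rintro _ ⟨⟨c, N⟩, rfl⟩
  exact h c N

lemma diffOp_X_linForm_pow (c : Fin n → k) (ρ : Fin n) (N : ℕ) :
    diffOp (MvPowerSeries.X ρ) (linForm c ^ N) = (N * c ρ) • linForm c ^ (N - 1) := by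
  have h : MvPolynomial.pderiv ρ (linForm c) = MvPolynomial.C (c ρ) := by
    classical
    simp [linForm, MvPolynomial.pderiv_X, Pi.single_apply, MvPolynomial.smul_eq_C_mul]
  rw [diffOp_X]
  simp only [Derivation.coeFn_coe, Derivation.leibniz_pow, h]
  rw [mul_smul, MvPolynomial.smul_eq_C_mul (a := c ρ), smul_eq_mul, mul_comm, Nat.cast_smul_eq_nsmul]

end Powers

lemma exists_perm_of_ofFn_perm {N n : ℕ} {f h : Fin N → Fin n}
    (hp : (List.ofFn f).Perm (List.ofFn h)) : ∃ σ : Equiv.Perm (Fin N), f ∘ σ = h := by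
  have h1 : List.ofFn (f ∘ Tuple.sort f) = List.ofFn (h ∘ Tuple.sort h) := by
    refine List.Perm.eq_of_sortedLE ?_ ?_ ?_
    · exact (Tuple.monotone_sort f).sortedLE_ofFn
    · exact (Tuple.monotone_sort h).sortedLE_ofFn
    · exact ((Equiv.Perm.ofFn_comp_perm _ _).trans hp).trans (Equiv.Perm.ofFn_comp_perm _ _).symm
  have h2 := List.ofFn_injective h1
  refine ⟨(Tuple.sort h).symm.trans (Tuple.sort f), ?_⟩
  ext i : 1
  have := congrFun h2 ((Tuple.sort h).symm i)
  simpa using this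

section Symmetrization

variable {k g : Type*} [Field k] [LieRing g] [LieAlgebra k g] {n : ℕ}
  (b : Module.Basis (Fin n) k g)

/-- In the definition of symmetrization the factors of a monomial may be listed in any order. -/
lemma coexp_monomial_sum_single {N : ℕ} (f : Fin N → Fin n) :
    coexp b (MvPolynomial.monomial (∑ i, Finsupp.single (f i) 1) 1) =
      ((N ! : ℕ) : k)⁻¹ • ∑ σ : Equiv.Perm (Fin N),
        (List.ofFn fun i => xhat b (f (σ i))).prod := by
  have h1 : ∀ (l : List (Fin n)) (N : ℕ) (f : Fin N → Fin n), l.Perm (List.ofFn f) →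
      ((l.length ! : ℕ) : k)⁻¹ • ∑ σ : Equiv.Perm (Fin l.length),
        (List.ofFn fun i => xhat b (l.get (σ i))).prod =
      ((N ! : ℕ) : k)⁻¹ • ∑ σ : Equiv.Perm (Fin N),
        (List.ofFn fun i => xhat b (f (σ i))).prod := by
    intro l N f hp
    obtain rfl : l.length = N := by simpa using hp.length_eq
    obtain ⟨τ, hτ⟩ := exists_perm_of_ofFn_perm (f := l.get) (h := f) (by rwa [List.ofFn_get])
    rw [← hτ, ← Equiv.sum_comp (Equiv.mulLeft τ)]
    rfl
  have h : MvPolynomial.monomial (∑ i, Finsupp.single (f i) 1) (1 : k) =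
    MvPolynomial.basisMonomials (Fin n) k (∑ i, Finsupp.single (f i) 1) := by simp
  rw [coexp, h, Module.Basis.constr_basis]
  refine h1 _ _ f ?_
  rw [← Multiset.coe_eq_coe, Multiset.coe_toList, map_sum]
  simp only [Finsupp.toMultiset_single, one_smul]
  rw [← Fin.univ_val_map, ← Multiset.sum_map_singleton (Multiset.map f _), Multiset.map_map]
  rfl

/-- Symmetrization maps powers of elements of the Lie algebra to powers. -/
lemma coexp_linForm_pow [CharZero k] (c : Fin n → k) (N : ℕ) :
    coexp b (linForm c ^ N) = (∑ i, c i • xhat b i) ^ N := by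
  rw [linForm_pow, map_sum, sum_smul_pow]
  simp only [map_smul, coexp_monomial_sum_single]
  have hN : ((N ! : ℕ) : k) ≠ 0 := Nat.cast_ne_zero.2 (Nat.factorial_ne_zero _)
  simp only [smul_comm _ ((N ! : ℕ) : k)⁻¹, Finset.smul_sum]
  rw [Finset.sum_comm]
  have h1 : ∀ σ : Equiv.Perm (Fin N), ∑ f : Fin N → Fin n, ((N ! : ℕ) : k)⁻¹ •
      (∏ i, c (f i)) • (List.ofFn fun i => xhat b (f (σ i))).prod =
      ((N ! : ℕ) : k)⁻¹ • ∑ f : Fin N → Fin n,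
      (∏ i, c (f i)) • (List.ofFn fun i => xhat b (f i)).prod := by
    intro σ
    rw [Finset.smul_sum]
    refine Fintype.sum_equiv (Equiv.arrowCongr σ.symm (Equiv.refl _)) _ _ fun f => ?_
    simp only [Equiv.arrowCongr_apply, Equiv.symm_symm, Equiv.coe_refl, Function.comp_apply, id_eq]
    rw [Equiv.prod_comp σ fun i => c (f i)]
  simp only [h1]
  rw [Finset.sum_const, Finset.card_univ, Fintype.card_perm, Fintype.card_fin,
    ← Nat.cast_smul_eq_nsmul k, smul_smul, mul_inv_cancel₀ hN, one_smul]

/-- The span of the products of at most `N` generators. -/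
def filtration (N : ℕ) : Submodule k (UniversalEnvelopingAlgebra k g) :=
  Submodule.span k {u | ∃ l : List (Fin n), l.length ≤ N ∧ u = (l.map (xhat b)).prod}

variable {b}

lemma prod_mem_filtration {l : List (Fin n)} {N : ℕ} (hl : l.length ≤ N) :
    (l.map (xhat b)).prod ∈ filtration b N :=
  Submodule.subset_span ⟨l, hl, rfl⟩

lemma xhat_mul_mem_filtration (i : Fin n) {N : ℕ} {u : UniversalEnvelopingAlgebra k g}
    (hu : u ∈ filtration b N) : xhat b i * u ∈ filtration b (N + 1) := by
  induction hu using Submodule.span_induction with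
  | mem u hu =>
    obtain ⟨l, hl, rfl⟩ := hu
    exact Submodule.subset_span ⟨i :: l, by simpa using hl, by simp⟩
  | zero => simp
  | add u v _ _ hu hv => rw [mul_add]; exact add_mem hu hv
  | smul c u _ hu => rw [mul_smul_comm]; exact Submodule.smul_mem _ _ hu

lemma ι_eq_sum (x : g) :
    UniversalEnvelopingAlgebra.ι k x = ∑ i, b.repr x i • xhat b i := by
  conv_lhs => rw [← b.sum_repr x]
  simp only [map_sum, map_smul, xhat]

attribute [local instance 100] LieRing.ofAssociativeRing

lemma xhat_lie (i j : Fin n) : xhat b i * xhat b j - xhat b j * xhat b i =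
    UniversalEnvelopingAlgebra.ι k ⁅b i, b j⁆ := by
  rw [LieHom.map_lie, LieRing.of_associative_ring_bracket]
  rfl

/-- A permutation of the factors changes a product only by a sum of shorter products. -/
lemma perm_sub_mem_filtration {l l' : List (Fin n)} (h : l.Perm l') :
    ∀ N, l.length ≤ N + 1 →
      (l.map (xhat b)).prod - (l'.map (xhat b)).prod ∈ filtration b N := by
  induction h with
  | nil => simp
  | @cons a l l' h ih =>
    intro N hN
    rw [List.length_cons] at hN
    cases N with
    | zero =>
      obtain rfl := List.length_eq_zero_iff.1 (by omega : l.length = 0)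
      obtain rfl := h.nil_eq
      simp
    | succ N =>
      rw [List.map_cons, List.map_cons, List.prod_cons, List.prod_cons, ← mul_sub]
      exact xhat_mul_mem_filtration a (ih N (by omega))
  | swap a c l =>
    intro N hN
    rw [List.length_cons, List.length_cons] at hN
    obtain ⟨N, rfl⟩ : ∃ N', N = N' + 1 := ⟨N - 1, by omega⟩
    simp only [List.map_cons, List.prod_cons, ← mul_assoc]
    rw [← sub_mul, xhat_lie, ι_eq_sum (b := b), Finset.sum_mul]
    refine sum_mem fun i _ => ?_
    rw [smul_mul_assoc]
    exact Submodule.smul_mem _ _ (xhat_mul_mem_filtration i (prod_mem_filtration (by omega)))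
  | trans h₁ h₂ ih₁ ih₂ =>
    intro N hN
    have := add_mem (ih₁ N hN) (ih₂ N (h₁.length_eq ▸ hN))
    rwa [sub_add_sub_cancel] at this

variable (b)

lemma filtration_le_range_coexp [CharZero k] (N : ℕ) :
    filtration b N ≤ LinearMap.range (coexp b) := by
  induction N with
  | zero =>
    rw [filtration, Submodule.span_le]
    rintro _ ⟨l, hl, rfl⟩
    obtain rfl := List.length_eq_zero_iff.1 (Nat.le_zero.1 hl)
    exact ⟨linForm 0 ^ 0, by rw [coexp_linForm_pow]; simp⟩
  | succ N ih =>
    rw [filtration, Submodule.span_le]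
    rintro _ ⟨l, hl, rfl⟩
    -- Modulo shorter products, a product is the average of its permutations.
    have hN : ((l.length ! : ℕ) : k) ≠ 0 := Nat.cast_ne_zero.2 (Nat.factorial_ne_zero _)
    have h1 : ∀ σ : Equiv.Perm (Fin l.length), (l.map (xhat b)).prod -
        (List.ofFn fun i => xhat b (l.get (σ i))).prod ∈ filtration b N := by
      intro σ
      have h2 : (List.ofFn fun i => xhat b (l.get (σ i))) =
          (List.ofFn (l.get ∘ σ)).map (xhat b) := by
        rw [List.map_ofFn]; rfl
      rw [h2]
      refine perm_sub_mem_filtration ?_ N hl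
      conv_lhs => rw [← List.ofFn_get l]
      exact (Equiv.Perm.ofFn_comp_perm σ l.get).symm
    have h3 : (l.map (xhat b)).prod =
        coexp b (MvPolynomial.monomial (∑ i, Finsupp.single (l.get i) 1) 1) +
        ((l.length ! : ℕ) : k)⁻¹ • ∑ σ : Equiv.Perm (Fin l.length), ((l.map (xhat b)).prod -
          (List.ofFn fun i => xhat b (l.get (σ i))).prod) := by
      rw [coexp_monomial_sum_single, ← smul_add, ← Finset.sum_add_distrib]
      simp only [add_sub_cancel]
      rw [Finset.sum_const, Finset.card_univ, Fintype.card_perm, Fintype.card_fin,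
        ← Nat.cast_smul_eq_nsmul k, smul_smul, inv_mul_cancel₀ hN, one_smul]
    rw [h3]
    exact add_mem (LinearMap.mem_range_self _ _)
      (Submodule.smul_mem _ _ (sum_mem fun σ _ => ih (h1 σ)))

lemma adjoin_xhat : Algebra.adjoin k (Set.range (xhat b)) = ⊤ := by
  have hs : Function.Surjective (UniversalEnvelopingAlgebra.mkAlgHom k g) :=
    Quotient.mk_surjective
  rw [eq_top_iff, ← (AlgHom.range_eq_top _).2 hs, ← Algebra.map_top,
    ← TensorAlgebra.adjoin_range_ι, AlgHom.map_adjoin, Algebra.adjoin_le_iff]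
  rintro _ ⟨_, ⟨x, rfl⟩, rfl⟩
  change UniversalEnvelopingAlgebra.ι k x ∈ _
  rw [ι_eq_sum (b := b)]
  exact sum_mem fun i _ => Subalgebra.smul_mem _ (Algebra.subset_adjoin (Set.mem_range_self i)) _

lemma coexp_surjective [CharZero k] : Function.Surjective (coexp b) := by
  rw [← LinearMap.range_eq_top, eq_top_iff, ← Algebra.top_toSubmodule, ← adjoin_xhat b,
    Algebra.adjoin_eq_span, Submodule.span_le]
  intro u hu
  obtain ⟨l, hl, rfl⟩ := Submonoid.exists_list_of_mem_closure hu
  obtain ⟨l, rfl⟩ : ∃ l' : List (Fin n), l'.map (xhat b) = l := by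
    rw [← Set.mem_range, Set.range_list_map]
    exact hl
  exact filtration_le_range_coexp b _ (prod_mem_filtration le_rfl)

end Symmetrization

/-! ### The action of the enveloping algebra on polynomials -/

section Representation

attribute [local instance 100] LieRing.ofAssociativeRing

variable {k g : Type*} [Field k] [LieRing g] [LieAlgebra k g] {n : ℕ}
  (b : Module.Basis (Fin n) k g)

lemma hasStructConst_baseChange :
    HasStructConst (Algebra.TensorProduct.basis (MvPowerSeries (Fin n) k) b) (structConst b) := by
  intro i j
  simp only [Algebra.TensorProduct.basis_apply]
  change (1 * 1 : MvPowerSeries (Fin n) k) ⊗ₜ[k] ⁅b i, b j⁆ = _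
  conv_lhs => rw [← b.sum_repr ⁅b i, b j⁆]
  simp only [TensorProduct.tmul_sum, TensorProduct.tmul_smul, TensorProduct.smul_tmul', mul_one,
    MvPowerSeries.smul_eq_C_mul, smul_eq_mul, structConst]

/-- The operator `∑ ρ, x_ρ φ^ρ_α(∂)` on polynomials which corresponds to the multiplication by
`x̂_α`. -/
def repOp (α : Fin n) : Module.End k (MvPolynomial (Fin n) k) :=
  ∑ ρ, LinearMap.mulLeft k (MvPolynomial.X ρ) * diffOp (fieldMatrix (structConst b) α ρ)

variable [CharZero k]

/-- The operators `repOp` represent the Lie algebra. The terms without derivatives of the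
coefficients cancel, and the others are given by the bracket of the vector fields. -/
lemma repOp_lie (α β : Fin n) :
    repOp b α * repOp b β - repOp b β * repOp b α = ∑ l, structConst b l α β • repOp b l := by
  have h := fieldMatrix_bracket (hasStructConst_baseChange b) α β
  set Φ := fieldMatrix (structConst b)
  have h1 : ∀ α β, repOp b α * repOp b β =
      ∑ ρ, ∑ σ, LinearMap.mulLeft k (MvPolynomial.X ρ * MvPolynomial.X σ) *
        diffOp (Φ α ρ * Φ β σ) +
      ∑ ρ, LinearMap.mulLeft k (MvPolynomial.X ρ) *
        diffOp (∑ σ, MvPowerSeries.pderiv k σ (Φ α ρ) * Φ β σ) := by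
    intro α β
    rw [repOp, repOp, Finset.sum_mul_sum]
    simp only [← Finset.sum_add_distrib, ← diffOpHom_apply, map_sum,
      Finset.mul_sum, map_mul]
    refine Finset.sum_congr rfl fun ρ _ => Finset.sum_congr rfl fun σ _ => ?_
    simp only [diffOpHom_apply]
    rw [mul_assoc, ← mul_assoc (diffOp _), diffOp_X_mul, LinearMap.mulLeft_mul]
    simp only [mul_add, add_mul, mul_assoc]
    rfl
  have h2 : ∑ ρ, ∑ σ, LinearMap.mulLeft k
      (MvPolynomial.X ρ * MvPolynomial.X σ : MvPolynomial (Fin n) k) * diffOp (Φ β ρ * Φ α σ) =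
      ∑ ρ, ∑ σ, LinearMap.mulLeft k (MvPolynomial.X ρ * MvPolynomial.X σ) *
        diffOp (Φ α ρ * Φ β σ) := by
    rw [Finset.sum_comm]
    exact Finset.sum_congr rfl fun ρ _ => Finset.sum_congr rfl fun σ _ => by
      rw [mul_comm, mul_comm (Φ β σ)]
  rw [h1, h1, h2, add_sub_add_left_eq_sub, ← Finset.sum_sub_distrib]
  simp only [repOp, Finset.smul_sum]
  rw [Finset.sum_comm]
  refine Finset.sum_congr rfl fun ρ _ => ?_
  rw [← mul_sub, ← diffOpHom_apply, ← diffOpHom_apply, ← map_sub, ← Finset.sum_sub_distrib, h ρ,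
    map_sum, Finset.mul_sum]
  refine Finset.sum_congr rfl fun l _ => ?_
  rw [← MvPowerSeries.smul_eq_C_mul, map_smul, mul_smul_comm]
  rfl

/-- The action of the Lie algebra on polynomials. -/
def lieRep : g →ₗ⁅k⁆ Module.End k (MvPolynomial (Fin n) k) :=
  { b.constr k (repOp b) with
    map_lie' := by
      intro x y
      simp only [LinearMap.coe_toAddHom, AddHom.toFun_eq_coe]
      rw [← b.sum_repr x, ← b.sum_repr y]
      simp only [sum_lie, lie_sum, smul_lie, lie_smul, map_sum, map_smul, b.constr_basis]
      refine Finset.sum_congr rfl fun i _ => ?_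
      rw [Finset.smul_sum]
      refine Finset.sum_congr rfl fun j _ => ?_
      rw [LieRing.of_associative_ring_bracket, smul_mul_smul_comm, smul_mul_smul_comm,
        mul_comm (b.repr y i) (b.repr x j), b.constr_apply_fintype k, smul_smul,
        mul_comm (b.repr y i)]
      exact (congrArg (_ • ·) (repOp_lie b j i).symm).trans (smul_sub _ _ _) }

/-- The action of the enveloping algebra on polynomials. -/
def rep : UniversalEnvelopingAlgebra k g →ₐ[k] Module.End k (MvPolynomial (Fin n) k) :=
  UniversalEnvelopingAlgebra.lift k (lieRep b)

lemma rep_xhat (α : Fin n) : rep b (xhat b α) = repOp b α := by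
  rw [rep, xhat, UniversalEnvelopingAlgebra.lift_ι_apply]
  exact b.constr_basis k _ α

/-- For `y = ∑ α, c_α x_α`, the operator `∑ α, c_α A(∂) α l` annihilates the powers of `y`: up to a
factor it produces the coordinates of `⁅y, y⁆ = 0`. -/
lemma sum_smul_diffOp_adMatrix (c : Fin n → k) (N : ℕ) (l : Fin n) :
    ∑ α, c α • diffOp (adMatrix (structConst b) α l) (linForm c ^ N) = 0 := by
  have h0 : ∑ α, ∑ ρ, c α * c ρ * structConst b l ρ α = 0 := by
    have h := lie_self (∑ ρ, c ρ • b ρ)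
    simp only [sum_lie, lie_sum, smul_lie, lie_smul] at h
    have h1 := congrArg (fun u => b.repr u l) h
    simp only [map_sum, map_smul, map_zero, Finsupp.finsetSum_apply, Finsupp.smul_apply,
      Finsupp.zero_apply, smul_eq_mul] at h1
    rw [← h1]
    simp only [Finset.mul_sum]
    refine Finset.sum_congr rfl fun ρ _ => Finset.sum_congr rfl fun α _ => ?_
    change _ * b.repr ⁅_, _⁆ l = _
    ring
  have h1 : ∀ α, diffOp (adMatrix (structConst b) α l) (linForm c ^ N) =
      ∑ ρ, (structConst b l ρ α * (N * c ρ)) • linForm c ^ (N - 1) := by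
    intro α
    simp only [adMatrix, ← MvPowerSeries.smul_eq_C_mul, ← diffOpHom_apply, map_sum, map_smul]
    simp only [LinearMap.sum_apply, LinearMap.smul_apply, diffOpHom_apply, diffOp_X_linForm_pow,
      smul_smul]
  simp only [h1, ← Finset.sum_smul, smul_smul]
  have h2 : ∀ α ρ, c α * (structConst b l ρ α * (N * c ρ)) =
    N * (c α * c ρ * structConst b l ρ α) := fun α ρ => by ring
  simp only [Finset.mul_sum, h2]
  simp only [← Finset.mul_sum, h0, mul_zero, zero_smul]

lemma sum_smul_diffOp_fieldMatrix (c : Fin n → k) (N : ℕ) (ρ : Fin n) :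
    ∑ α, c α • diffOp (fieldMatrix (structConst b) α ρ) (linForm c ^ N) =
      c ρ • linForm c ^ N := by
  classical
  -- Only the constant term of `fieldMatrix` contributes: it has the form `1 + A * Ψ`.
  obtain ⟨Ψ, hΨ⟩ : ∃ Ψ, fieldMatrix (structConst b) = 1 + adMatrix (structConst b) * Ψ := by
    refine ⟨evalSeries (adMatrix (structConst b))
      (PowerSeries.mk fun s => PowerSeries.coeff (s + 1) (bernoulliSeries k)), ?_⟩
    have h1 := PowerSeries.eq_X_mul_shift_add_const (bernoulliSeries k)
    have h2 : PowerSeries.constantCoeff (bernoulliSeries k) = 1 := by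
      simp [bernoulliSeries, ← PowerSeries.coeff_zero_eq_constantCoeff_apply]
    rw [h2, map_one, add_comm] at h1
    rw [fieldMatrix, h1, evalSeries_add, evalSeries_one,
      evalSeries_mul isLinearMatrix_adMatrix, evalSeries_X isLinearMatrix_adMatrix, ← h1]
  have h3 : ∀ α, diffOp (fieldMatrix (structConst b) α ρ) (linForm c ^ N) =
      (if α = ρ then linForm c ^ N else 0) +
        ∑ l, diffOp (Ψ l ρ) (diffOp (adMatrix (structConst b) α l) (linForm c ^ N)) := by
    intro α
    rw [hΨ, Matrix.add_apply, Matrix.mul_apply, ← diffOpHom_apply, map_add, map_sum,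
      LinearMap.add_apply, Matrix.one_apply]
    congr 1
    · split_ifs
      · rw [map_one, Module.End.one_apply]
      · rw [map_zero, LinearMap.zero_apply]
    · simp only [LinearMap.sum_apply]
      exact Finset.sum_congr rfl fun l _ => by rw [mul_comm, map_mul]; rfl
  simp only [h3, smul_add, Finset.sum_add_distrib, Finset.smul_sum]
  rw [Finset.sum_comm]
  have h4 : ∀ l, ∑ α, c α • diffOp (Ψ l ρ)
      (diffOp (adMatrix (structConst b) α l) (linForm c ^ N)) = 0 := by
    intro l
    rw [← map_zero (diffOp (Ψ l ρ)), ← sum_smul_diffOp_adMatrix b c N l, map_sum]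
    exact Finset.sum_congr rfl fun α _ => (map_smul _ _ _).symm
  simp [h4]

/-- On the powers of a linear form, the operator of the same linear form acts by multiplication,
since all terms with a bracket vanish by antisymmetry. -/
lemma sum_smul_repOp_linForm_pow (c : Fin n → k) (N : ℕ) :
    (∑ α, c α • repOp b α) (linForm c ^ N) = linForm c ^ (N + 1) := by
  simp only [repOp, LinearMap.sum_apply, LinearMap.smul_apply, Module.End.mul_apply,
    LinearMap.mulLeft_apply, Finset.smul_sum]
  rw [Finset.sum_comm, pow_succ', linForm, Finset.sum_mul]
  refine Finset.sum_congr rfl fun ρ _ => ?_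
  simp only [← mul_smul_comm, ← Finset.mul_sum]
  rw [← linForm, sum_smul_diffOp_fieldMatrix, mul_smul_comm, smul_mul_assoc]

/-- The action on the constant polynomial `1` is a left inverse of symmetrization. -/
lemma rep_coexp (f : MvPolynomial (Fin n) k) : rep b (coexp b f) 1 = f := by
  have h : (LinearMap.applyₗ (1 : MvPolynomial (Fin n) k)) ∘ₗ (rep b).toLinearMap ∘ₗ coexp b =
      LinearMap.id := by
    refine linearMap_ext_pow fun c N => ?_
    simp only [LinearMap.comp_apply, coexp_linForm_pow, AlgHom.toLinearMap_apply, map_pow, map_sum,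
      map_smul, rep_xhat, LinearMap.applyₗ_apply_apply, LinearMap.id_apply]
    induction N with
    | zero => simp
    | succ N ih => rw [pow_succ', Module.End.mul_apply, ih, sum_smul_repOp_linForm_pow]
  exact LinearMap.congr_fun h f

lemma coexp_injective : Function.Injective (coexp b) :=
  Function.LeftInverse.injective (g := fun u => rep b u 1) (rep_coexp b)

theorem coexp_bijective : Function.Bijective (coexp b) :=
  ⟨coexp_injective b, coexp_surjective b⟩

end Representation

/-! ### Deformed derivatives and their commutators -/

section Commutators

variable {k g : Type*} [Field k] [CharZero k] [LieRing g] [LieAlgebra k g] {n : ℕ}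
  (b : Module.Basis (Fin n) k g)

lemma coexpInv_eq : coexpInv b = (LinearEquiv.ofBijective (coexp b) (coexp_bijective b)).symm := by
  rw [coexpInv, dif_pos (coexp_bijective b)]

@[simp]
lemma coexpInv_coexp (f : MvPolynomial (Fin n) k) : coexpInv b (coexp b f) = f := by
  rw [coexpInv_eq]
  exact (LinearEquiv.ofBijective (coexp b) (coexp_bijective b)).symm_apply_apply f

@[simp]
lemma coexp_coexpInv (u : UniversalEnvelopingAlgebra k g) : coexp b (coexpInv b u) = u := by
  rw [coexpInv_eq]
  exact (LinearEquiv.ofBijective (coexp b) (coexp_bijective b)).apply_symm_apply u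

lemma coexp_one : coexp b 1 = 1 := by
  simpa using coexp_linForm_pow b 0 0

/-- Symmetrization intertwines `repOp` with the multiplication by generators. -/
lemma coexp_repOp (α : Fin n) (f : MvPolynomial (Fin n) k) :
    coexp b (repOp b α f) = xhat b α * coexp b f := by
  apply Function.LeftInverse.injective (g := coexp b) (f := coexpInv b) (coexp_coexpInv b)
  rw [coexpInv_coexp]
  have h : ∀ u, coexpInv b u = rep b u 1 := fun u => by
    rw [← rep_coexp b (coexpInv b u), coexp_coexpInv]
  rw [h, map_mul, Module.End.mul_apply, rep_coexp, rep_xhat]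

/-- The algebra homomorphism `P ↦ P(∂̂)`. -/
def hatHom : MvPowerSeries (Fin n) k →ₐ[k] Module.End k (UniversalEnvelopingAlgebra k g) :=
  AlgHom.ofLinearMap
    { toFun := hat b
      map_add' := fun P Q => by
        ext u
        simp [hat, ← diffOpHom_apply]
      map_smul' := fun c P => by
        ext u
        simp [hat, ← diffOpHom_apply] }
    (by ext u; simp [hat, diffOp_one])
    (fun P Q => by ext u; simp [hat, diffOp_mul])

@[simp]
lemma hatHom_apply (P : MvPowerSeries (Fin n) k) : hatHom b P = hat b P := rfl

lemma hat_coexp (P : MvPowerSeries (Fin n) k) (f : MvPolynomial (Fin n) k) :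
    hat b P (coexp b f) = coexp b (diffOp P f) := by
  simp [hat]

lemma dhat_eq_hat (μ : Fin n) : dhat b μ = hat b (MvPowerSeries.X μ) := by
  rw [dhat, hat, diffOp_X]

/-- The derivation of formal power series which corresponds to the commutator with `x̂_α`. -/
def bracketDeriv (α : Fin n) :
    Derivation k (MvPowerSeries (Fin n) k) (MvPowerSeries (Fin n) k) :=
  ∑ ρ, fieldMatrix (structConst b) α ρ • MvPowerSeries.pderiv k ρ

omit [CharZero k] in
lemma bracketDeriv_apply (α : Fin n) (P : MvPowerSeries (Fin n) k) :
    bracketDeriv b α P =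
      ∑ ρ, fieldMatrix (structConst b) α ρ * MvPowerSeries.pderiv k ρ P := by
  rw [bracketDeriv, ← Derivation.coeFnAddMonoidHom_apply, map_sum, Finset.sum_apply]
  rfl

lemma hat_commutator (α : Fin n) (P : MvPowerSeries (Fin n) k) :
    hat b P * xop b α - xop b α * hat b P = hat b (bracketDeriv b α P) := by
  have h : diffOp P * repOp b α - repOp b α * diffOp P = diffOp (bracketDeriv b α P) := by
    rw [bracketDeriv_apply, repOp, Finset.mul_sum, Finset.sum_mul, ← Finset.sum_sub_distrib,
      ← diffOpHom_apply (∑ ρ, _), map_sum]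
    refine Finset.sum_congr rfl fun ρ _ => ?_
    rw [← mul_assoc, diffOp_X_mul, mul_assoc, ← diffOp_mul, mul_comm _ P, diffOp_mul, add_mul,
      mul_assoc, add_sub_cancel_left, ← diffOp_mul, mul_comm]
    rfl
  ext u
  obtain ⟨f, rfl⟩ := coexp_surjective b u
  rw [LinearMap.sub_apply, Module.End.mul_apply, Module.End.mul_apply, hat_coexp, hat_coexp, ← h]
  simp only [xop, LinearMap.mulLeft_apply, ← coexp_repOp, hat_coexp, ← map_sub]
  rfl

/-- The formal power series of the operator `[[…[P(∂̂), x̂_{α_1}], …], x̂_{α_w}]`. -/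
def nestedSeries (P : MvPowerSeries (Fin n) k) (l : List (Fin n)) : MvPowerSeries (Fin n) k :=
  l.foldl (fun Q a => bracketDeriv b a Q) P

lemma hat_foldl_commutator (l : List (Fin n)) (P : MvPowerSeries (Fin n) k) :
    l.foldl (fun T i => T * xop b i - xop b i * T) (hat b P) = hat b (nestedSeries b P l) := by
  induction l generalizing P with
  | nil => rfl
  | cons a l ih => rw [List.foldl_cons, hat_commutator, ih]; rfl

lemma nestedBracket_eq_hat (μ : Fin n) {w : ℕ} (α : Fin w → Fin n) :
    nestedBracket b μ α = hat b (nestedSeries b (MvPowerSeries.X μ) (List.ofFn α)) := by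
  rw [nestedBracket, dhat_eq_hat, hat_foldl_commutator]

lemma prod_dhat_eq_hat {w : ℕ} (α : Fin w → Fin n) :
    (List.ofFn fun i => dhat b (α i)).prod =
      hat b (∏ i, (MvPowerSeries.X (α i) : MvPowerSeries (Fin n) k)) := by
  rw [← hatHom_apply, ← List.prod_ofFn, map_list_prod, List.map_ofFn]
  simp only [dhat_eq_hat]
  rfl

end Commutators

lemma sum_snoc {M : Type*} [AddCommMonoid M] {n w : ℕ} (F : (Fin (w + 1) → Fin n) → M) :
    ∑ α, F α = ∑ a, ∑ α : Fin w → Fin n, F (Fin.snoc α a) := by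
  rw [← (Fin.snocEquiv fun _ => Fin n).sum_comp, Fintype.sum_prod_type]
  rfl

/-! ### The Leibniz rule -/

section Leibniz

/-- Moving an element past a power: `T X^N = ∑ w, C(N, w) X^(N - w) [[…[T, X], …], X]`. -/
lemma mul_pow_eq_sum_commutator {A : Type*} [Ring A] (X T : A) (N : ℕ) :
    T * X ^ N = ∑ w ∈ Finset.range (N + 1),
      N.choose w • (X ^ (N - w) * (fun S => S * X - X * S)^[w] T) := by
  set L : Module.End ℤ A := LinearMap.mulLeft ℤ X
  set R : Module.End ℤ A := LinearMap.mulRight ℤ X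
  have hc : Commute (R - L) L :=
    Commute.sub_left (LinearMap.commute_mulLeft_right (R := ℤ) X X).symm (Commute.refl L)
  have h := LinearMap.congr_fun (hc.add_pow N) T
  have h1 : (R ^ N) T = T * X ^ N := by rw [LinearMap.pow_mulRight]; rfl
  rw [sub_add_cancel, h1] at h
  rw [h, LinearMap.sum_apply]
  refine Finset.sum_congr rfl fun w _ => ?_
  rw [(hc.pow_pow w (N - w)).eq, ← nsmul_eq_mul', LinearMap.smul_apply, Module.End.mul_apply,
    Module.End.pow_apply (R - L), LinearMap.pow_mulLeft]
  rfl

variable {k g : Type*} [Field k] [CharZero k] [LieRing g] [LieAlgebra k g] {n : ℕ}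
  (b : Module.Basis (Fin n) k g)

omit [CharZero k] in
lemma nestedBracket_snoc (μ : Fin n) {w : ℕ} (α : Fin w → Fin n) (a : Fin n) :
    nestedBracket b μ (Fin.snoc α a : Fin (w + 1) → Fin n) =
      nestedBracket b μ α * xop b a - xop b a * nestedBracket b μ α := by
  rw [nestedBracket, List.ofFn_succ_last]
  simp [nestedBracket]

omit [CharZero k] in
lemma iterate_commutator_eq_sum (μ : Fin n) (c : Fin n → k) (w : ℕ) :
    (fun S => S * (∑ i, c i • xop b i) - (∑ i, c i • xop b i) * S)^[w] (dhat b μ) =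
      ∑ α : Fin w → Fin n, (∏ i, c (α i)) • nestedBracket b μ α := by
  induction w with
  | zero => simp [nestedBracket]
  | succ w ih =>
    rw [Function.iterate_succ_apply', ih, sum_snoc, Finset.sum_mul_sum, Finset.sum_mul_sum,
      Finset.sum_comm, ← Finset.sum_sub_distrib]
    refine Finset.sum_congr rfl fun a _ => ?_
    rw [← Finset.sum_sub_distrib]
    refine Finset.sum_congr rfl fun α _ => ?_
    simp only [nestedBracket_snoc, Fin.snoc_castSucc, Fin.snoc_last, Fin.prod_univ_castSucc]
    rw [smul_mul_smul_comm, smul_mul_smul_comm, smul_sub, mul_comm (c a)]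

lemma hat_prod_X_linForm_pow (c : Fin n → k) (N : ℕ) {w : ℕ} (α : Fin w → Fin n) :
    hat b (∏ i, MvPowerSeries.X (α i)) ((∑ i, c i • xhat b i) ^ N) =
      (N.descFactorial w * ∏ i, c (α i)) • (∑ i, c i • xhat b i) ^ (N - w) := by
  induction w with
  | zero =>
    rw [← hatHom_apply, Finset.univ_eq_empty, Finset.prod_empty, map_one]
    simp
  | succ w ih =>
    rw [Fin.prod_univ_castSucc, Fin.prod_univ_castSucc, mul_comm, ← hatHom_apply, map_mul,
      hatHom_apply, hatHom_apply, Module.End.mul_apply, ih, map_smul, ← coexp_linForm_pow,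
      hat_coexp, diffOp_X_linForm_pow, map_smul, coexp_linForm_pow, smul_smul, Nat.sub_sub,
      Nat.descFactorial_succ]
    congr 1
    push_cast
    ring

/-- On `X ^ N ⊗ v`, with `X` in the Lie algebra, the terms of the coproduct become the summands of
`mul_pow_eq_sum_commutator`, since `∂̂^{α_1} ⋯ ∂̂^{α_w}` differentiates a power of `X` like a
polynomial. -/
lemma mul'_bracketTerm (μ : Fin n) (w : ℕ) (c : Fin n → k) (N : ℕ)
    (v : UniversalEnvelopingAlgebra k g) :
    LinearMap.mul' k _ (bracketTerm b μ w (((∑ i, c i • xhat b i) ^ N) ⊗ₜ v)) =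
      N.choose w • ((∑ i, c i • xhat b i) ^ (N - w) *
        (fun S => S * (∑ i, c i • xop b i) - (∑ i, c i • xop b i) * S)^[w] (dhat b μ) v) := by
  rw [bracketTerm, iterate_commutator_eq_sum]
  simp only [LinearMap.smul_apply, LinearMap.sum_apply, TensorProduct.map_tmul, map_smul, map_sum,
    LinearMap.mul'_apply, prod_dhat_eq_hat, hat_prod_X_linForm_pow, Finset.mul_sum, Finset.smul_sum,
    smul_mul_assoc, mul_smul_comm, smul_smul]
  refine Finset.sum_congr rfl fun α _ => ?_
  rw [← Nat.cast_smul_eq_nsmul k, smul_smul, ← mul_assoc, Nat.descFactorial_eq_factorial_mul_choose]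
  congr 2
  have : ((w ! : ℕ) : k) ≠ 0 := Nat.cast_ne_zero.2 (Nat.factorial_ne_zero _)
  push_cast
  field_simp

/-- The deformed Leibniz rule for a left factor which is a power of an element of the Lie algebra. -/
lemma dhat_mul (μ : Fin n) (c : Fin n → k) (N : ℕ) (v : UniversalEnvelopingAlgebra k g) :
    dhat b μ ((∑ i, c i • xhat b i) ^ N * v) = ∑ w ∈ Finset.range (N + 1),
      LinearMap.mul' k _ (bracketTerm b μ w (((∑ i, c i • xhat b i) ^ N) ⊗ₜ v)) := by
  have h1 : ∀ N : ℕ, (∑ i, c i • xop b i) ^ N =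
      LinearMap.mulLeft k ((∑ i, c i • xhat b i) ^ N) := by
    intro N
    rw [← LinearMap.pow_mulLeft]
    congr 1
    ext u
    simp [xop, Finset.sum_mul]
  have h := LinearMap.congr_fun (mul_pow_eq_sum_commutator (∑ i, c i • xop b i) (dhat b μ) N) v
  rw [h1, Module.End.mul_apply, LinearMap.mulLeft_apply] at h
  rw [h, LinearMap.sum_apply]
  refine Finset.sum_congr rfl fun w _ => ?_
  rw [mul'_bracketTerm, h1]
  rfl

lemma mul'_bracketTerm_eq_zero (μ : Fin n) {w N : ℕ} (hw : N < w) (c : Fin n → k)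
    (v : UniversalEnvelopingAlgebra k g) :
    LinearMap.mul' k _ (bracketTerm b μ w (((∑ i, c i • xhat b i) ^ N) ⊗ₜ v)) = 0 := by
  rw [mul'_bracketTerm, Nat.choose_eq_zero_of_lt hw, zero_smul]

end Leibniz

/-! ### Operators on the tensor square -/

section TensorSquare

variable {k : Type*} [Field k] {n : ℕ}

/-- The element `P ⊗ Q` of the completed tensor square. -/
def tensorSeries (P Q : MvPowerSeries (Fin n) k) : MvPowerSeries (Fin n ⊕ Fin n) k :=
  fun m => MvPowerSeries.coeff (m.comapDomain Sum.inl Sum.inl_injective.injOn) P *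
    MvPowerSeries.coeff (m.comapDomain Sum.inr Sum.inr_injective.injOn) Q

lemma coeff_tensorSeries (P Q : MvPowerSeries (Fin n) k) (m : Fin n ⊕ Fin n →₀ ℕ) :
    MvPowerSeries.coeff m (tensorSeries P Q) =
      MvPowerSeries.coeff (m.comapDomain Sum.inl Sum.inl_injective.injOn) P *
        MvPowerSeries.coeff (m.comapDomain Sum.inr Sum.inr_injective.injOn) Q := rfl

lemma diffOp₂_tmul (D : MvPowerSeries (Fin n ⊕ Fin n) k) (a c : Fin n →₀ ℕ) :
    diffOp₂ D (MvPolynomial.monomial a 1 ⊗ₜ MvPolynomial.monomial c 1) =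
      ∑ p ∈ Finset.HasAntidiagonal.antidiagonal a, ∑ q ∈ Finset.HasAntidiagonal.antidiagonal c,
        MvPowerSeries.coeff (Finsupp.sumElim p.1 q.1) D •
          (diffOp (MvPowerSeries.monomial p.1 (1 : k)) (MvPolynomial.monomial a 1) ⊗ₜ[k]
            diffOp (MvPowerSeries.monomial q.1 (1 : k)) (MvPolynomial.monomial c 1)) := by
  have h : (MvPolynomial.monomial a (1 : k) ⊗ₜ[k] MvPolynomial.monomial c (1 : k)) =
      (MvPolynomial.basisMonomials (Fin n) k).tensorProduct
        (MvPolynomial.basisMonomials (Fin n) k) (a, c) := by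
    simp [Module.Basis.tensorProduct_apply]
  rw [diffOp₂, h, Module.Basis.constr_basis]

lemma linearMap_ext_tmul_monomial {V : Type*} [AddCommGroup V] [Module k V]
    {S T : MvPolynomial (Fin n) k ⊗[k] MvPolynomial (Fin n) k →ₗ[k] V}
    (h : ∀ a c, S (MvPolynomial.monomial a 1 ⊗ₜ MvPolynomial.monomial c 1) =
      T (MvPolynomial.monomial a 1 ⊗ₜ MvPolynomial.monomial c 1)) : S = T := by
  refine ((MvPolynomial.basisMonomials (Fin n) k).tensorProduct
    (MvPolynomial.basisMonomials (Fin n) k)).ext fun ac => ?_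
  obtain ⟨a, c⟩ := ac
  rw [Module.Basis.tensorProduct_apply, MvPolynomial.coe_basisMonomials]
  exact h a c

/-- The dependence of `diffOp₂ D` on `D`: the value at a vector only involves finitely many
coefficients of `D`. -/
lemma exists_diffOp₂_eq_sum (z : MvPolynomial (Fin n) k ⊗[k] MvPolynomial (Fin n) k) :
    ∃ V : (Fin n ⊕ Fin n →₀ ℕ) →₀ MvPolynomial (Fin n) k ⊗[k] MvPolynomial (Fin n) k,
      ∀ D, diffOp₂ D z = V.sum fun m v => MvPowerSeries.coeff m D • v := by
  have hz : z ∈ Submodule.span k (Set.range ((MvPolynomial.basisMonomials (Fin n) k).tensorProduct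
    (MvPolynomial.basisMonomials (Fin n) k))) := by rw [Module.Basis.span_eq]; trivial
  induction hz using Submodule.span_induction with
  | mem z hz =>
    obtain ⟨⟨a, c⟩, rfl⟩ := hz
    refine ⟨∑ p ∈ Finset.HasAntidiagonal.antidiagonal a,
      ∑ q ∈ Finset.HasAntidiagonal.antidiagonal c, Finsupp.single (Finsupp.sumElim p.1 q.1)
        (diffOp (MvPowerSeries.monomial p.1 (1 : k)) (MvPolynomial.monomial a 1) ⊗ₜ[k]
          diffOp (MvPowerSeries.monomial q.1 (1 : k)) (MvPolynomial.monomial c 1)), fun D => ?_⟩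
    rw [Module.Basis.tensorProduct_apply, MvPolynomial.coe_basisMonomials, diffOp₂_tmul,
      ← Finsupp.sum_finsetSum_index (by simp) (by simp [smul_add])]
    refine Finset.sum_congr rfl fun p _ => ?_
    rw [← Finsupp.sum_finsetSum_index (by simp) (by simp [smul_add])]
    refine Finset.sum_congr rfl fun q _ => ?_
    rw [Finsupp.sum_single_index (by simp)]
  | zero => exact ⟨0, by simp⟩
  | add z z' _ _ h h' =>
    obtain ⟨V, hV⟩ := h
    obtain ⟨V', hV'⟩ := h'
    exact ⟨V + V', fun D => by
      rw [map_add, hV, hV', Finsupp.sum_add_index' (by simp) (by simp [smul_add])]⟩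
  | smul r z _ h =>
    obtain ⟨V, hV⟩ := h
    exact ⟨r • V, fun D => by
      rw [map_smul, hV, Finsupp.sum_smul_index' (by simp), Finsupp.smul_sum]
      simp only [smul_comm r]⟩

lemma eq_of_mem_antidiagonal {a : Fin n →₀ ℕ} {p q : (Fin n →₀ ℕ) × (Fin n →₀ ℕ)}
    (hp : p ∈ Finset.HasAntidiagonal.antidiagonal a)
    (hq : q ∈ Finset.HasAntidiagonal.antidiagonal a) (h : p.1 = q.1) : p = q := by
  rw [Finset.HasAntidiagonal.mem_antidiagonal] at hp hq
  exact Prod.ext h (add_left_cancel (a := p.1) (by rw [hp, h, hq]))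

variable [CharZero k]

lemma diffOp_monomial_eq_sum (P : MvPowerSeries (Fin n) k) (a : Fin n →₀ ℕ) :
    diffOp P (MvPolynomial.monomial a 1) = ∑ p ∈ Finset.HasAntidiagonal.antidiagonal a,
      MvPowerSeries.coeff p.1 P •
        diffOp (MvPowerSeries.monomial p.1 (1 : k)) (MvPolynomial.monomial a 1) := by
  classical
  rw [monomial_eq_smul_dpow, map_smul, diffOp_dpow, Finset.smul_sum]
  refine Finset.sum_congr rfl fun p hp => ?_
  rw [map_smul, smul_comm, diffOp_dpow, Finset.sum_eq_single p]
  · simp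
  · intro q hq hne
    rw [MvPowerSeries.coeff_monomial, if_neg, zero_smul]
    exact fun h => hne (eq_of_mem_antidiagonal hq hp h)
  · exact fun h => absurd hp h

lemma diffOp_monomial_self (a : Fin n →₀ ℕ) :
    diffOp (MvPowerSeries.monomial a (1 : k)) (MvPolynomial.monomial a 1) =
      ((∏ i, (a i)! : ℕ) : k) • 1 := by
  classical
  rw [monomial_eq_smul_dpow, map_smul, diffOp_dpow, Finset.sum_eq_single (a, 0)]
  · simp [dpow]
  · intro q hq hne
    rw [MvPowerSeries.coeff_monomial, if_neg, zero_smul]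
    exact fun h => hne (eq_of_mem_antidiagonal hq (by simp) h)
  · simp

lemma diffOp₂_tensorSeries (P Q : MvPowerSeries (Fin n) k) :
    diffOp₂ (tensorSeries P Q) = TensorProduct.map (diffOp P) (diffOp Q) := by
  refine linearMap_ext_tmul_monomial fun a c => ?_
  rw [diffOp₂_tmul, TensorProduct.map_tmul, diffOp_monomial_eq_sum P, diffOp_monomial_eq_sum Q,
    TensorProduct.sum_tmul]
  refine Finset.sum_congr rfl fun p _ => ?_
  rw [TensorProduct.tmul_sum]
  refine Finset.sum_congr rfl fun q _ => ?_
  rw [coeff_tensorSeries, Finsupp.comapDomain_inl_sumElim, Finsupp.comapDomain_inr_sumElim,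
    TensorProduct.smul_tmul_smul]

/-- `D ↦ diffOp₂ D` as a linear map. -/
def diffOp₂Hom (k : Type*) [Field k] (n : ℕ) : MvPowerSeries (Fin n ⊕ Fin n) k →ₗ[k]
    Module.End k (MvPolynomial (Fin n) k ⊗[k] MvPolynomial (Fin n) k) where
  toFun := diffOp₂
  map_add' D D' := linearMap_ext_tmul_monomial fun a c => by
    simp [diffOp₂_tmul, add_smul, Finset.sum_add_distrib]
  map_smul' r D := linearMap_ext_tmul_monomial fun a c => by
    simp [diffOp₂_tmul, Finset.smul_sum, smul_smul]

variable {g : Type*} [LieRing g] [LieAlgebra k g] (b : Module.Basis (Fin n) k g)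

/-- `D ↦ hat₂ D` as a linear map. -/
def hat₂Hom : MvPowerSeries (Fin n ⊕ Fin n) k →ₗ[k]
    Module.End k (UniversalEnvelopingAlgebra k g ⊗[k] UniversalEnvelopingAlgebra k g) where
  toFun := hat₂ b
  map_add' D D' := by
    ext u v
    have := LinearMap.congr_fun (map_add (diffOp₂Hom k n) D D') (coexpInv b u ⊗ₜ coexpInv b v)
    simp only [diffOp₂Hom, LinearMap.coe_mk, AddHom.coe_mk] at this
    simp [hat₂, this]
  map_smul' r D := by
    ext u v
    have := LinearMap.congr_fun (map_smul (diffOp₂Hom k n) r D) (coexpInv b u ⊗ₜ coexpInv b v)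
    simp only [diffOp₂Hom, LinearMap.coe_mk, AddHom.coe_mk] at this
    simp [hat₂, this]

omit [CharZero k] in
@[simp]
lemma hat₂Hom_apply (D : MvPowerSeries (Fin n ⊕ Fin n) k) : hat₂Hom b D = hat₂ b D := rfl

lemma hat₂_tensorSeries (P Q : MvPowerSeries (Fin n) k) :
    hat₂ b (tensorSeries P Q) = TensorProduct.map (hat b P) (hat b Q) := by
  ext u v
  simp [hat₂, diffOp₂_tensorSeries, hat]

omit [CharZero k] in
/-- Convergence of coefficients implies pointwise convergence of the operators. -/
lemma HasFormalSum.hasPointwiseSum {σ : Type*} {f : σ → MvPowerSeries (Fin n ⊕ Fin n) k}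
    {D : MvPowerSeries (Fin n ⊕ Fin n) k} (h : HasFormalSum f D) :
    HasPointwiseSum (fun s => hat₂ b (f s)) (hat₂ b D) := by
  intro z
  obtain ⟨V, hV⟩ := exists_diffOp₂_eq_sum (TensorProduct.map (coexpInv b) (coexpInv b) z)
  have h1 : ∀ D, hat₂ b D z =
      V.sum fun m v => MvPowerSeries.coeff m D • TensorProduct.map (coexp b) (coexp b) v := by
    intro D
    rw [hat₂, LinearMap.comp_apply, LinearMap.comp_apply, hV, Finsupp.sum, map_sum]
    simp only [map_smul]
    rfl
  have hfin : (⋃ m ∈ V.support, {s | MvPowerSeries.coeff m (f s) ≠ 0}).Finite :=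
    V.support.finite_toSet.biUnion fun m _ => (h m).1
  have hsub : ∀ m ∈ V.support, {s | MvPowerSeries.coeff m (f s) ≠ 0} ⊆ hfin.toFinset := by
    intro m hm s hs
    rw [Set.Finite.coe_toFinset]
    exact Set.mem_biUnion hm hs
  have hsub2 : {s | hat₂ b (f s) z ≠ 0} ⊆ hfin.toFinset := by
    intro s hs
    rw [Set.Finite.coe_toFinset]
    by_contra hns
    simp only [Set.mem_iUnion, not_exists] at hns
    refine hs ?_
    rw [h1]
    refine Finset.sum_eq_zero fun m hm => ?_
    beta_reduce
    rw [not_not.1 (hns m hm), zero_smul]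
  refine ⟨hfin.toFinset.finite_toSet.subset hsub2, ?_⟩
  rw [finsum_eq_sum_of_support_subset _ hsub2]
  simp only [h1, Finsupp.sum]
  rw [Finset.sum_comm]
  refine Finset.sum_congr rfl fun m hm => ?_
  rw [← Finset.sum_smul, (h m).2, finsum_eq_sum_of_support_subset _ (hsub m hm)]

end TensorSquare

/-! ### The deformed coproduct -/

section Coproduct

variable {k g : Type*} [Field k] [CharZero k] [LieRing g] [LieAlgebra k g] {n : ℕ}
  (b : Module.Basis (Fin n) k g)

/-- The element of the completed tensor square which acts as `bracketTerm b μ w`. -/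
def bracketTermSeries (μ : Fin n) (w : ℕ) : MvPowerSeries (Fin n ⊕ Fin n) k :=
  ((w ! : ℕ) : k)⁻¹ • ∑ α : Fin w → Fin n, tensorSeries
    (∏ i, (MvPowerSeries.X (α i))) (nestedSeries b (MvPowerSeries.X μ) (List.ofFn α))

lemma hat₂_bracketTermSeries (μ : Fin n) (w : ℕ) :
    hat₂ b (bracketTermSeries b μ w) = bracketTerm b μ w := by
  rw [bracketTermSeries, ← hat₂Hom_apply, map_smul, map_sum, bracketTerm]
  simp only [hat₂Hom_apply, hat₂_tensorSeries, nestedBracket_eq_hat, prod_dhat_eq_hat]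

/-- The deformed coproduct of `∂̂^μ`, the sum of all `bracketTermSeries b μ w`. As the term for `w`
is homogeneous of degree `w` in the left variables, only one `w` contributes to a coefficient. -/
def coproduct (μ : Fin n) : MvPowerSeries (Fin n ⊕ Fin n) k := fun m =>
  MvPowerSeries.coeff m
    (bracketTermSeries b μ (m.comapDomain Sum.inl Sum.inl_injective.injOn).degree)

omit [CharZero k] in
lemma coeff_prod_X_of_degree_ne {w : ℕ} (α : Fin w → Fin n) {m : Fin n →₀ ℕ} (h : m.degree ≠ w) :
    MvPowerSeries.coeff m (∏ i, (MvPowerSeries.X (α i) : MvPowerSeries (Fin n) k)) = 0 := by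
  classical
  simp only [MvPowerSeries.X]
  rw [MvPowerSeries.prod_monomial, MvPowerSeries.coeff_monomial, if_neg]
  rintro rfl
  simp at h

omit [CharZero k] in
lemma coeff_bracketTermSeries_of_ne (μ : Fin n) {w : ℕ} {m : Fin n ⊕ Fin n →₀ ℕ}
    (h : (m.comapDomain Sum.inl Sum.inl_injective.injOn).degree ≠ w) :
    MvPowerSeries.coeff m (bracketTermSeries b μ w) = 0 := by
  rw [bracketTermSeries, map_smul, map_sum, Finset.sum_eq_zero, smul_zero]
  intro α _
  rw [coeff_tensorSeries, coeff_prod_X_of_degree_ne α h, zero_mul]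

omit [CharZero k] in
lemma hasFormalSum_coproduct (μ : Fin n) :
    HasFormalSum (bracketTermSeries b μ) (coproduct b μ) := by
  intro m
  set w₀ := (m.comapDomain Sum.inl Sum.inl_injective.injOn).degree with hw₀
  have hsub : {w | MvPowerSeries.coeff m (bracketTermSeries b μ w) ≠ 0} ⊆ ({w₀} : Finset ℕ) := by
    intro w hw
    by_contra hne
    exact hw (coeff_bracketTermSeries_of_ne b μ fun h => hne (by simp [← h, hw₀]))
  refine ⟨(Finset.finite_toSet _).subset hsub, ?_⟩
  rw [finsum_eq_sum_of_support_subset _ hsub, Finset.sum_singleton]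
  rfl

lemma hasPointwiseSum_bracketTerm (μ : Fin n) :
    HasPointwiseSum (bracketTerm b μ) (hat₂ b (coproduct b μ)) := by
  have h := (hasFormalSum_coproduct b μ).hasPointwiseSum b
  simpa only [hat₂_bracketTermSeries] using h

lemma isDeformedCoproduct_coproduct (μ : Fin n) : IsDeformedCoproduct b μ (coproduct b μ) := by
  intro u v
  obtain ⟨f, rfl⟩ := coexp_surjective b u
  -- Both sides are linear in `f`, so `f` may be assumed to be a power of a linear form.
  have h : dhat b μ ∘ₗ LinearMap.mulRight k v ∘ₗ coexp b =
      LinearMap.mul' k _ ∘ₗ hat₂ b (coproduct b μ) ∘ₗ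
        (TensorProduct.mk k _ _).flip v ∘ₗ coexp b := by
    refine linearMap_ext_pow fun c N => ?_
    simp only [LinearMap.comp_apply, LinearMap.mulRight_apply, coexp_linForm_pow, dhat_mul,
      LinearMap.flip_apply, TensorProduct.mk_apply]
    obtain ⟨hfin, hsum⟩ := hasPointwiseSum_bracketTerm b μ (((∑ i, c i • xhat b i) ^ N) ⊗ₜ v)
    rw [hsum, map_finsum _ hfin]
    symm
    refine finsum_eq_sum_of_support_subset _ fun w hw => ?_
    by_contra hne
    refine hw (mul'_bracketTerm_eq_zero b μ ?_ c v)
    simpa using hne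
  exact LinearMap.congr_fun h f

/-- An element of the completed tensor square is determined by its action followed by the
multiplication: if the coefficients of degree less than `|p| + |q|` vanish, then `x^p ⊗ x^q` is
mapped to `p! q! D_(p,q)`. -/
lemma eq_zero_of_mul'_hat₂_eq_zero {D : MvPowerSeries (Fin n ⊕ Fin n) k}
    (h : ∀ u v, LinearMap.mul' k _ (hat₂ b D (u ⊗ₜ v)) = 0) : D = 0 := by
  have key : ∀ (d : ℕ) (p q : Fin n →₀ ℕ), p.degree + q.degree = d →
      MvPowerSeries.coeff (Finsupp.sumElim p q) D = 0 := by
    intro d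
    induction d using Nat.strong_induction_on with
    | _ d ih =>
    intro p q hpq
    have h1 := h (coexp b (MvPolynomial.monomial p 1)) (coexp b (MvPolynomial.monomial q 1))
    rw [hat₂, LinearMap.comp_apply, LinearMap.comp_apply, TensorProduct.map_tmul, coexpInv_coexp,
      coexpInv_coexp, diffOp₂_tmul, Finset.sum_eq_single (p, 0), Finset.sum_eq_single (q, 0),
      diffOp_monomial_self, diffOp_monomial_self] at h1
    · simp only [map_smul, TensorProduct.map_tmul, LinearMap.mul'_apply, coexp_one,
        smul_mul_smul_comm, smul_smul, mul_one, smul_eq_zero] at h1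
      have hne : (1 : UniversalEnvelopingAlgebra k g) ≠ 0 := by
        rw [← coexp_one b, ← map_zero (coexp b)]
        exact (coexp_injective b).ne one_ne_zero
      simpa [prod_factorial_ne_zero, hne, Finset.prod_eq_zero_iff, Nat.factorial_ne_zero] using h1
    · rintro ⟨q', q''⟩ hq' hne
      rw [Finset.HasAntidiagonal.mem_antidiagonal] at hq'
      simp only at hq'
      subst hq'
      rw [ih (p.degree + q'.degree) _ p q' rfl, zero_smul]
      have : q''.degree ≠ 0 := by
        rw [Ne, Finsupp.degree_eq_zero_iff]
        rintro rfl
        simp at hne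
      rw [← hpq, map_add]
      omega
    · simp
    · rintro ⟨p', p''⟩ hp' hne
      rw [Finset.HasAntidiagonal.mem_antidiagonal] at hp'
      simp only at hp'
      subst hp'
      refine Finset.sum_eq_zero fun q' hq' => ?_
      rw [Finset.HasAntidiagonal.mem_antidiagonal] at hq'
      subst hq'
      rw [ih (p'.degree + q'.1.degree) _ p' q'.1 rfl, zero_smul]
      have : p''.degree ≠ 0 := by
        rw [Ne, Finsupp.degree_eq_zero_iff]
        rintro rfl
        simp at hne
      rw [← hpq, map_add, map_add]
      omega
    · simp
  ext m
  rw [← Finsupp.comapDomain_sumElim_comapDomain m, key _ _ _ rfl, MvPowerSeries.coeff_zero]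

lemma IsDeformedCoproduct.unique {μ : Fin n} {D D' : MvPowerSeries (Fin n ⊕ Fin n) k}
    (h : IsDeformedCoproduct b μ D) (h' : IsDeformedCoproduct b μ D') : D' = D := by
  rw [← sub_eq_zero]
  refine eq_zero_of_mul'_hat₂_eq_zero b fun u v => ?_
  rw [← hat₂Hom_apply, map_sub, LinearMap.sub_apply, map_sub, hat₂Hom_apply, hat₂Hom_apply, ← h,
    ← h', sub_self]

lemma expGenerator_pow_apply (μ : Fin n) (w : ℕ) :
    (expGenerator b ^ w) (1 ⊗ₜ[k] dhat b μ) = ∑ α : Fin w → Fin n,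
      (List.ofFn fun i => dhat b (α i)).prod ⊗ₜ[k] nestedBracket b μ α := by
  induction w with
  | zero => simp [nestedBracket]
  | succ w ih =>
    rw [pow_succ', Module.End.mul_apply, ih, sum_snoc, expGenerator, LinearMap.sum_apply]
    refine Finset.sum_congr rfl fun a _ => ?_
    rw [map_sum]
    refine Finset.sum_congr rfl fun α _ => ?_
    rw [TensorProduct.map_tmul, nestedBracket_snoc]
    congr 1
    · -- The new factor is multiplied from the left; the deformed derivatives commute.
      rw [LinearMap.mulLeft_apply, prod_dhat_eq_hat, prod_dhat_eq_hat, dhat_eq_hat,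
        Fin.prod_univ_castSucc]
      simp only [Fin.snoc_castSucc, Fin.snoc_last]
      simp only [← hatHom_apply]
      rw [← map_mul, mul_comm]
    · simp only [LinearMap.sub_apply, LinearMap.mulLeft_apply, LinearMap.mulRight_apply]
      have h : ∀ S T : Module.End k (UniversalEnvelopingAlgebra k g),
          -S * T - T * -S = T * S - S * T := fun S T => LinearMap.ext fun u => by
        simp only [LinearMap.sub_apply, Module.End.mul_apply, LinearMap.neg_apply, map_neg]
        abel
      exact h _ _

lemma expTerm_eq_bracketTerm (μ : Fin n) (w : ℕ) : expTerm b μ w = bracketTerm b μ w := by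
  rw [expTerm, LinearMap.smul_apply, map_smul, expGenerator_pow_apply, map_sum, bracketTerm]
  simp only [TensorProduct.homTensorHomMap_apply]

end Coproduct

/-! ### Grafting a node onto a tree -/

namespace PlanarTree

variable {Λ : Type}

/-- The number of black nodes. -/
def leaves : PlanarTree Λ → ℕ
  | black => 1
  | white _ _ c => ∑ i, (c i).leaves

open Classical in
/-- The trees which arise from a tree by replacing one black leaf by a white node with label `β`
and `s` black children. -/
def grafts (β : Λ) (s : ℕ) : PlanarTree Λ → Finset (PlanarTree Λ)
  | black => {white β s fun _ => black}
  | white a m c => Finset.univ.biUnion fun i =>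
      ((c i).grafts β s).image fun x => white a m (Function.update c i x)

open Classical in
/-- Replace all white nodes with label `β` by black leaves. -/
def prune (β : Λ) : PlanarTree Λ → PlanarTree Λ
  | black => black
  | white a m c => if a = β then black else white a m fun i => (c i).prune β

variable {β : Λ} {s : ℕ}

lemma mem_grafts_white {a : Λ} {m : ℕ} {c : Fin m → PlanarTree Λ} {x : PlanarTree Λ} :
    x ∈ (white a m c).grafts β s ↔
      ∃ i, ∃ y ∈ (c i).grafts β s, white a m (Function.update c i y) = x := by
  simp [grafts]

lemma labels_of_mem_grafts {t x : PlanarTree Λ} (hx : x ∈ t.grafts β s) :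
    x.labels = β ::ₘ t.labels := by
  induction t generalizing x with
  | black =>
    rw [grafts, Finset.mem_singleton] at hx
    simp [hx, labels]
  | white a m c ih =>
    obtain ⟨i, y, hy, rfl⟩ := mem_grafts_white.1 hx
    rw [labels, labels, Multiset.cons_swap, ← Finset.add_sum_erase _ _ (Finset.mem_univ i),
      ← Finset.add_sum_erase _ (fun j => (c j).labels) (Finset.mem_univ i),
      Function.update_self, ih i hy, Multiset.cons_add]
    congr 3
    refine Finset.sum_congr rfl fun j hj => ?_
    rw [Function.update_of_ne (Finset.ne_of_mem_erase hj)]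

lemma leaves_of_mem_grafts {t x : PlanarTree Λ} (hx : x ∈ t.grafts β s) :
    x.leaves + 1 = t.leaves + s ∧ s ≤ x.leaves := by
  induction t generalizing x with
  | black =>
    rw [grafts, Finset.mem_singleton] at hx
    simp [hx, leaves, add_comm]
  | white a m c ih =>
    obtain ⟨i, y, hy, rfl⟩ := mem_grafts_white.1 hx
    have h := ih i hy
    have h1 : ∑ j ∈ Finset.univ.erase i, (Function.update c i y j).leaves =
        ∑ j ∈ Finset.univ.erase i, (c j).leaves :=
      Finset.sum_congr rfl fun j hj => by
        rw [Function.update_of_ne (Finset.ne_of_mem_erase hj)]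
    rw [leaves, leaves, ← Finset.add_sum_erase _ _ (Finset.mem_univ i),
      ← Finset.add_sum_erase _ (fun j => (c j).leaves) (Finset.mem_univ i),
      Function.update_self, h1]
    omega

lemma mem_labels_of_mem_child {a : Λ} {m : ℕ} {c : Fin m → PlanarTree Λ} {l : Λ} (i : Fin m)
    (h : l ∈ (c i).labels) : l ∈ (white a m c).labels := by
  rw [labels, Multiset.mem_cons, Multiset.mem_sum]
  exact Or.inr ⟨i, Finset.mem_univ i, h⟩

lemma mem_labels_white {a : Λ} {m : ℕ} {c : Fin m → PlanarTree Λ} {l : Λ} :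
    l ∈ (white a m c).labels ↔ l = a ∨ ∃ i, l ∈ (c i).labels := by
  simp [labels, Multiset.mem_sum]

lemma prune_of_notMem {t : PlanarTree Λ} (ht : β ∉ t.labels) : t.prune β = t := by
  induction t with
  | black => rfl
  | white a m c ih =>
    rw [mem_labels_white, not_or, not_exists] at ht
    rw [prune, if_neg (Ne.symm ht.1)]
    congr 1
    ext i : 1
    exact ih i (ht.2 i)

lemma prune_of_mem_grafts {t x : PlanarTree Λ} (ht : β ∉ t.labels) (hx : x ∈ t.grafts β s) :
    x.prune β = t := by
  induction t generalizing x with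
  | black =>
    rw [grafts, Finset.mem_singleton] at hx
    simp [hx, prune]
  | white a m c ih =>
    obtain ⟨i, y, hy, rfl⟩ := mem_grafts_white.1 hx
    rw [mem_labels_white, not_or, not_exists] at ht
    rw [prune, if_neg (Ne.symm ht.1)]
    congr 1
    ext j : 1
    by_cases hj : j = i
    · subst hj
      rw [Function.update_self, ih j (ht.2 j) hy]
    · rw [Function.update_of_ne hj, prune_of_notMem (ht.2 j)]

section Sum

variable {M : Type*} [AddCommMonoid M]

lemma sum_grafts_white {a : Λ} {m : ℕ} {c : Fin m → PlanarTree Λ} (h : ∀ i, β ∉ (c i).labels)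
    (f : PlanarTree Λ → M) : ∑ x ∈ (white a m c).grafts β s, f x =
      ∑ i, ∑ y ∈ (c i).grafts β s, f (white a m (Function.update c i y)) := by
  classical
  rw [grafts, Finset.sum_biUnion]
  · refine Finset.sum_congr rfl fun i _ => ?_
    refine Finset.sum_image fun y _ y' _ hy => ?_
    simp only [white.injEq, heq_eq_eq, true_and] at hy
    exact Function.update_injective c i hy
  · intro i _ j _ hij
    rw [Function.onFun, Finset.disjoint_left]
    intro x hx hx'
    obtain ⟨y, hy, rfl⟩ := Finset.mem_image.1 hx
    obtain ⟨y', hy', he⟩ := Finset.mem_image.1 hx'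
    simp only [white.injEq, heq_eq_eq, true_and] at he
    have h1 := congrFun he i
    rw [Function.update_self, Function.update_of_ne hij] at h1
    refine h i ?_
    rw [h1, labels_of_mem_grafts hy]
    exact Multiset.mem_cons_self _ _

end Sum

section Order

variable [LinearOrder Λ]

lemma descending_of_mem_grafts {t x : PlanarTree Λ} (hd : t.Descending)
    (hβ : ∀ l ∈ t.labels, l < β) (hx : x ∈ t.grafts β s) :
    x.Descending ∧ ∀ l ∈ x.rootLabel, l = β ∨ l ∈ t.rootLabel := by
  induction t generalizing x with
  | black =>
    rw [grafts, Finset.mem_singleton] at hx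
    simp [hx, Descending, rootLabel]
  | white a m c ih =>
    obtain ⟨i, y, hy, rfl⟩ := mem_grafts_white.1 hx
    refine ⟨fun j => ?_, by simp [rootLabel]⟩
    by_cases hj : j = i
    · subst hj
      rw [Function.update_self]
      have h := ih j (hd j).2 (fun l hl => hβ l (mem_labels_of_mem_child j hl)) hy
      refine ⟨fun l hl => ?_, h.1⟩
      rcases h.2 l hl with rfl | hl
      · exact hβ a (mem_labels_white.2 (Or.inl rfl))
      · exact (hd j).1 l hl
    · rw [Function.update_of_ne hj]
      exact hd j

/-- A tree in which the largest label `β` occurs once arises by grafting the node `β`, whose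
children are black. -/
lemma exists_mem_grafts {x : PlanarTree Λ} (hd : x.Descending) (hβ : ∀ l ∈ x.labels, l ≤ β)
    (h1 : x.labels.count β = 1) :
    ∃ (s : ℕ) (t : PlanarTree Λ), x ∈ t.grafts β s ∧ t.Descending ∧ ∀ l ∈ t.rootLabel, l ∈ x.rootLabel := by
  induction x with
  | black => simp [labels] at h1
  | white a m c ih =>
    by_cases ha : a = β
    · subst ha
      have hc : c = fun _ => black := by
        ext i : 1
        rcases hci : c i with _ | ⟨l, m', c'⟩
        · rfl
        · have h2 := (hd i).1 l (by rw [hci]; rfl)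
          have h3 := hβ l (mem_labels_of_mem_child i (by rw [hci]; exact mem_labels_white.2 (.inl rfl)))
          exact absurd h2 (not_lt.2 h3)
      refine ⟨m, black, ?_, trivial, by simp [rootLabel]⟩
      rw [grafts, Finset.mem_singleton, hc]
    · rw [labels, Multiset.count_cons_of_ne (Ne.symm ha), Multiset.count_sum'] at h1
      obtain ⟨i, -, hi⟩ := Finset.exists_ne_zero_of_sum_ne_zero (h1.trans_ne one_ne_zero)
      have hle := Finset.single_le_sum (f := fun i => (c i).labels.count β)
        (fun _ _ => Nat.zero_le _) (Finset.mem_univ i)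
      rw [h1] at hle
      obtain ⟨s, t, ht, htd, htr⟩ := ih i (hd i).2
        (fun l hl => hβ l (mem_labels_of_mem_child i hl)) (by omega)
      refine ⟨s, white a m (Function.update c i t), ?_, fun j => ?_, by simp [rootLabel]⟩
      · refine mem_grafts_white.2 ⟨i, c i, ?_, ?_⟩
        · rwa [Function.update_self]
        · rw [Function.update_idem, Function.update_eq_self]
      · by_cases hj : j = i
        · subst hj
          rw [Function.update_self]
          exact ⟨fun l hl => (hd j).1 l (htr l hl), htd⟩
        · rw [Function.update_of_ne hj]
          exact hd j

end Order

/-! ### Finiteness of the set of trees -/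

lemma finite_labels_leaves [Finite Λ] (N : ℕ) :
    {t : PlanarTree Λ | t.labels.card + t.leaves ≤ N}.Finite := by
  induction N with
  | zero =>
    refine Set.Finite.subset Set.finite_empty fun t ht => ?_
    cases t with
    | black => simp [leaves, labels] at ht
    | white a m c => simp [labels] at ht
  | succ N ih =>
    -- Each child has a node, so that a tree with `N + 1` nodes branches into at most `N` children.
    have hpos : ∀ t : PlanarTree Λ, 1 ≤ t.labels.card + t.leaves := by
      intro t
      cases t with
      | black => simp [leaves]
      | white a m c => simp [labels]; omega
    refine Set.Finite.subset ((Set.finite_singleton black).union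
      (Set.Finite.biUnion (Set.finite_univ (α := Λ)) fun a _ => Set.Finite.biUnion
        (Set.finite_le_nat N) fun m _ => (Set.Finite.pi' fun _ : Fin m => ih).image
          fun c => white a m c)) fun t ht => ?_
    cases t with
    | black => exact Or.inl rfl
    | white a m c =>
      have h1 : ∑ i, ((c i).labels.card + (c i).leaves) ≤ N := by
        rw [Finset.sum_add_distrib]
        simp only [Set.mem_ofPred_eq, labels, leaves, Multiset.card_cons, Multiset.card_sum] at ht
        omega
      refine Or.inr (Set.mem_biUnion (Set.mem_univ a) (Set.mem_biUnion ?_ ⟨c, fun i => ?_, rfl⟩))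
      · refine le_trans ?_ h1
        calc m = ∑ _i : Fin m, 1 := by simp
          _ ≤ _ := Finset.sum_le_sum fun i _ => hpos (c i)
      · exact (Finset.single_le_sum (f := fun i => (c i).labels.card + (c i).leaves)
          (fun _ _ => Nat.zero_le _) (Finset.mem_univ i)).trans h1

section OrderedTrees

variable [LinearOrder Λ] [Finite Λ]

lemma finite_orderedTrees (l : Multiset Λ) (d : ℕ) :
    {t : PlanarTree Λ | t.labels = l ∧ t.Descending ∧ t.leaves = d}.Finite :=
  (finite_labels_leaves (l.card + d)).subset fun t ht => by
    simp only [Set.mem_ofPred_eq] at ht ⊢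
    rw [ht.1, ht.2.2]

/-- The ordered trees with white labels `l` and `d` black nodes. -/
def orderedTrees (l : Multiset Λ) (d : ℕ) : Finset (PlanarTree Λ) :=
  (finite_orderedTrees l d).toFinset

lemma mem_orderedTrees {l : Multiset Λ} {d : ℕ} {t : PlanarTree Λ} :
    t ∈ orderedTrees l d ↔ t.labels = l ∧ t.Descending ∧ t.leaves = d := by
  rw [orderedTrees, Set.Finite.mem_toFinset, Set.mem_ofPred_eq]

/-- Every ordered tree arises in a unique way from a tree without its largest label by grafting. -/
lemma sum_orderedTrees_cons {M : Type*} [AddCommMonoid M] {l : Multiset Λ} (hl : ∀ x ∈ l, x < β)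
    (d : ℕ) (f : PlanarTree Λ → M) :
    ∑ x ∈ orderedTrees (β ::ₘ l) d, f x = ∑ s ∈ Finset.range (d + 1),
      ∑ t ∈ orderedTrees l (d + 1 - s), ∑ x ∈ t.grafts β s, f x := by
  classical
  have hβ : β ∉ l := fun h => lt_irrefl _ (hl β h)
  have hU : orderedTrees (β ::ₘ l) d =
      ((Finset.range (d + 1)).sigma fun s => orderedTrees l (d + 1 - s)).biUnion
        fun x => x.2.grafts β x.1 := by
    ext x
    simp only [Finset.mem_biUnion, Finset.mem_sigma, Finset.mem_range, mem_orderedTrees]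
    constructor
    · rintro ⟨hxl, hxd, hxe⟩
      obtain ⟨s, t, hx, htd, -⟩ := exists_mem_grafts (β := β) hxd (fun y hy => by
        rw [hxl, Multiset.mem_cons] at hy
        rcases hy with rfl | hy
        · exact le_rfl
        · exact (hl y hy).le) (by
        rw [hxl, Multiset.count_cons_self, Multiset.count_eq_zero_of_notMem hβ])
      have h1 := labels_of_mem_grafts hx
      have h2 := leaves_of_mem_grafts hx
      rw [hxl, Multiset.cons_inj_right] at h1
      have h3 : s < d + 1 := by omega
      have h4 : t.leaves = d + 1 - s := by omega
      exact ⟨⟨s, t⟩, ⟨h3, h1.symm, htd, h4⟩, hx⟩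
    · rintro ⟨⟨s, t⟩, ⟨hs, rfl, htd, hte⟩, hx⟩
      have h2 := leaves_of_mem_grafts hx
      exact ⟨labels_of_mem_grafts hx, (descending_of_mem_grafts htd hl hx).1, by
        change s < d + 1 at hs
        change t.leaves = d + 1 - s at hte
        change x.leaves + 1 = t.leaves + s ∧ _ at h2
        omega⟩
  rw [hU, Finset.sum_biUnion, Finset.sum_sigma]
  rintro ⟨s, t⟩ hst ⟨s', t'⟩ hst' hne
  rw [Function.onFun, Finset.disjoint_left]
  intro x hx hx'
  simp only [Finset.coe_sigma, Set.mem_sigma_iff, Finset.mem_coe, mem_orderedTrees] at hst hst' hx hx'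
  obtain rfl : t = t' := by
    rw [← prune_of_mem_grafts (by rw [hst.2.1]; exact hβ) hx,
      prune_of_mem_grafts (by rw [hst'.2.1]; exact hβ) hx']
  obtain rfl : s = s' := by
    have h1 := leaves_of_mem_grafts hx
    have h2 := leaves_of_mem_grafts hx'
    omega
  exact hne rfl

lemma orderedTrees_zero (d : ℕ) :
    orderedTrees (0 : Multiset Λ) d = if d = 1 then {black} else ∅ := by
  ext t
  rw [mem_orderedTrees]
  cases t with
  | black => split_ifs with h <;> simp [labels, leaves, Descending, h, eq_comm]
  | white a m c => split_ifs <;> simp [labels]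

end OrderedTrees

end PlanarTree

/-! ### Evaluation of trees and commutators -/

lemma derivation_finset_prod {R A ι : Type*} [CommSemiring R] [CommSemiring A] [Algebra R A]
    [DecidableEq ι] (D : Derivation R A A) (s : Finset ι) (f : ι → A) :
    D (∏ i ∈ s, f i) = ∑ i ∈ s, (∏ j ∈ s.erase i, f j) * D (f i) := by
  induction s using Finset.induction_on with
  | empty => simp
  | insert a s ha ih =>
    rw [Finset.prod_insert ha, Derivation.leibniz, ih, Finset.sum_insert ha,
      Finset.erase_insert ha, smul_eq_mul, smul_eq_mul, Finset.mul_sum, add_comm]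
    congr 1
    refine Finset.sum_congr rfl fun i hi => ?_
    have hne : a ≠ i := fun h => ha (h ▸ hi)
    rw [Finset.erase_insert_of_ne hne, Finset.prod_insert fun h => ha (Finset.mem_of_mem_erase h),
      mul_assoc]

section Evaluation

variable {k g : Type*} [Field k] [LieRing g] [LieAlgebra k g] {n : ℕ}
  (b : Module.Basis (Fin n) k g)

lemma isHomogeneous_ev (t : PlanarTree (Fin n)) (μ : Fin n) :
    (ev b t μ).IsHomogeneous t.leaves := by
  induction t generalizing μ with
  | black => exact MvPolynomial.isHomogeneous_X k μ
  | white a s c ih =>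
    rw [ev, PlanarTree.leaves]
    refine MvPolynomial.IsHomogeneous.sum _ _ _ fun ρ _ => ?_
    rw [← zero_add (∑ i, _)]
    exact (MvPolynomial.isHomogeneous_C _ _).mul
      (MvPolynomial.IsHomogeneous.prod _ _ _ fun i _ => ih i (ρ i))

/-- The evaluation of a white node whose children are black. -/
def nodePoly (s : ℕ) (a μ : Fin n) : MvPolynomial (Fin n) k :=
  ev b (.white a s fun _ => .black) μ

lemma coeff_nodePoly_of_ne {s : ℕ} (a μ : Fin n) {m : Fin n →₀ ℕ} (h : m.degree ≠ s) :
    MvPolynomial.coeff m (nodePoly b s a μ) = 0 := by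
  refine (isHomogeneous_ev b _ μ).coeff_eq_zero ?_
  simpa [PlanarTree.leaves] using h

lemma adMatrix_structConst (a l : Fin n) :
    adMatrix (structConst b) a l =
      -∑ ρ, MvPowerSeries.C (structConst b l a ρ) * MvPowerSeries.X ρ := by
  rw [adMatrix, ← Finset.sum_neg_distrib]
  refine Finset.sum_congr rfl fun ρ _ => ?_
  rw [structConst, structConst, ← lie_skew, map_neg, Finsupp.neg_apply, map_neg, neg_mul]

lemma adMatrix_pow_apply (s : ℕ) (a μ : Fin n) :
    (adMatrix (structConst b) ^ s) a μ = ∑ ρ : Fin s → Fin n,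
      MvPowerSeries.C ((-1) ^ s * chain b μ a (List.ofFn ρ)) * ∏ i, MvPowerSeries.X (ρ i) := by
  induction s generalizing a with
  | zero => simp [chain, Matrix.one_apply, apply_ite]
  | succ s ih =>
    rw [pow_succ', Matrix.mul_apply, ← (Fin.consEquiv fun _ => Fin n).sum_comp,
      Fintype.sum_prod_type]
    simp only [ih, adMatrix_structConst, Fin.consEquiv_apply, List.ofFn_succ, chain,
      Fin.prod_univ_succ, Fin.cons_zero, Fin.cons_succ]
    simp only [neg_mul, Finset.sum_mul, Finset.mul_sum, map_sum, ← Finset.sum_neg_distrib]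
    refine (Finset.sum_congr rfl fun l _ => Finset.sum_comm).trans (Finset.sum_comm.trans ?_)
    refine Finset.sum_congr rfl fun ρ _ => Finset.sum_comm.trans ?_
    refine Finset.sum_congr rfl fun ρs _ => Finset.sum_congr rfl fun l _ => ?_
    simp only [map_mul, map_neg, map_pow, map_one]
    ring

/-- The Taylor coefficients of the vector fields `∑ ρ, fieldMatrix a ρ * ∂/∂(∂^ρ)` are the
evaluations of the white nodes. -/
lemma coeff_fieldMatrix (a μ : Fin n) (m : Fin n →₀ ℕ) :
    MvPowerSeries.coeff m (fieldMatrix (structConst b) a μ) =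
      MvPolynomial.coeff m (nodePoly b m.degree a μ) := by
  rw [fieldMatrix, coeff_evalSeries, adMatrix_pow_apply, nodePoly, ev, ← MvPolynomial.coeff_coe,
    bernoulliSeries, PowerSeries.coeff_mk, ← MvPowerSeries.coeff_C_mul, Finset.mul_sum,
    ← MvPolynomial.coeToMvPowerSeries.ringHom_apply,
    map_sum MvPolynomial.coeToMvPowerSeries.ringHom]
  refine congrArg (MvPowerSeries.coeff m) (Finset.sum_congr rfl fun ρ _ => ?_)
  simp only [map_mul, map_prod, MvPolynomial.coeToMvPowerSeries.ringHom_apply,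
    MvPolynomial.coe_C, MvPolynomial.coe_X, ev, vertex]
  simp only [← mul_assoc, ← map_mul]
  refine congrArg (fun x => MvPowerSeries.C x * _) ?_
  ring

/-- The homogeneous component of `bracketDeriv` which comes from white nodes with `s` children. -/
def nodeDeriv (s : ℕ) (a : Fin n) :
    Derivation k (MvPolynomial (Fin n) k) (MvPolynomial (Fin n) k) :=
  MvPolynomial.mkDerivation k (nodePoly b s a)

lemma nodeDeriv_X (s : ℕ) (a μ : Fin n) :
    nodeDeriv b s a (MvPolynomial.X μ) = nodePoly b s a μ :=
  MvPolynomial.mkDerivation_X _ _ _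

lemma nodeDeriv_apply (s : ℕ) (a : Fin n) (f : MvPolynomial (Fin n) k) :
    nodeDeriv b s a f = ∑ ρ, nodePoly b s a ρ * MvPolynomial.pderiv ρ f := by
  have h : nodeDeriv b s a = ∑ ρ, nodePoly b s a ρ • MvPolynomial.pderiv ρ := by
    refine MvPolynomial.derivation_ext fun μ => ?_
    rw [nodeDeriv_X, ← Derivation.coeFnAddMonoidHom_apply, map_sum, Finset.sum_apply]
    simp [MvPolynomial.pderiv_X, Pi.single_apply]
  rw [h, ← Derivation.coeFnAddMonoidHom_apply, map_sum, Finset.sum_apply]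
  rfl

/-- The derivation `nodeDeriv` grafts a white node with `s` black children onto the black leaves, one
at a time. -/
lemma nodeDeriv_ev {Λ : Type} {β : Λ} (s : ℕ) (α : Λ → Fin n) {t : PlanarTree Λ}
    (ht : β ∉ t.labels) (μ : Fin n) :
    nodeDeriv b s (α β) (ev b (t.relabel α) μ) =
      ∑ x ∈ t.grafts β s, ev b (x.relabel α) μ := by
  induction t generalizing μ with
  | black =>
    rw [PlanarTree.grafts, Finset.sum_singleton, PlanarTree.relabel, ev, nodeDeriv_X]
    rfl
  | white a m c ih =>
    rw [PlanarTree.mem_labels_white, not_or, not_exists] at ht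
    rw [PlanarTree.sum_grafts_white ht.2, PlanarTree.relabel, ev, map_sum]
    simp only [PlanarTree.relabel, ev, Derivation.leibniz, MvPolynomial.derivation_C,
      smul_eq_mul, mul_zero, add_zero, derivation_finset_prod, ih _ (ht.2 _), Finset.mul_sum]
    rw [Finset.sum_comm]
    refine Finset.sum_congr rfl fun i _ => ?_
    rw [Finset.sum_comm]
    refine Finset.sum_congr rfl fun y _ => Finset.sum_congr rfl fun ρ _ => ?_
    rw [← Finset.mul_prod_erase Finset.univ _ (Finset.mem_univ i), Function.update_self,
      mul_comm (∏ j ∈ _, _)]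
    congr 2
    refine Finset.prod_congr rfl fun j hj => ?_
    rw [Function.update_of_ne (Finset.ne_of_mem_erase hj)]

/-- The action of `bracketDeriv` on a series whose component of degree `d` is that of `Q d`. A node
with `s` children raises the degree by `s - 1`. -/
lemma coeff_bracketDeriv {P : MvPowerSeries (Fin n) k} {Q : ℕ → MvPolynomial (Fin n) k}
    (h : ∀ m, MvPowerSeries.coeff m P = MvPolynomial.coeff m (Q m.degree)) (a : Fin n)
    (m : Fin n →₀ ℕ) :
    MvPowerSeries.coeff m (bracketDeriv b a P) = ∑ s ∈ Finset.range (m.degree + 1),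
      MvPolynomial.coeff m (nodeDeriv b s a (Q (m.degree + 1 - s))) := by
  classical
  simp only [bracketDeriv_apply, nodeDeriv_apply, map_sum, MvPolynomial.coeff_sum]
  rw [Finset.sum_comm]
  refine Finset.sum_congr rfl fun ρ _ => ?_
  simp only [MvPolynomial.coeff_mul, MvPowerSeries.coeff_mul]
  rw [Finset.sum_comm]
  refine Finset.sum_congr rfl fun p hp => ?_
  rw [Finset.HasAntidiagonal.mem_antidiagonal] at hp
  have hd : m.degree = p.1.degree + p.2.degree := by rw [← hp, map_add]
  rw [Finset.sum_eq_single p.1.degree]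
  · rw [coeff_fieldMatrix, MvPowerSeries.coeff_pderiv, MvPolynomial.coeff_pderiv, h, map_add,
      Finsupp.degree_single, hd, show p.1.degree + p.2.degree + 1 - p.1.degree =
      p.2.degree + 1 by omega]
  · intro s _ hs
    rw [coeff_nodePoly_of_ne b _ _ hs.symm, zero_mul]
  · intro hs
    rw [Finset.mem_range] at hs
    omega

/-- The iterated commutators are the sums of the evaluations of the ordered trees, where the labels
of the tree, in increasing order, are the positions of the brackets. -/
lemma coeff_nestedSeries {Λ : Type} [LinearOrder Λ] [Finite Λ] (μ : Fin n) (α : Λ → Fin n)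
    (l : List Λ) (hl : l.Pairwise (· < ·)) (m : Fin n →₀ ℕ) :
    MvPowerSeries.coeff m (nestedSeries b (MvPowerSeries.X μ) (l.map α)) =
      MvPolynomial.coeff m
        (∑ t ∈ PlanarTree.orderedTrees (l : Multiset Λ) m.degree, ev b (t.relabel α) μ) := by
  classical
  induction l using List.reverseRecOn generalizing m with
  | nil =>
    rw [Multiset.coe_nil, PlanarTree.orderedTrees_zero, List.map_nil, nestedSeries, List.foldl_nil,
      ← MvPolynomial.coe_X, MvPolynomial.coeff_coe]
    split_ifs with h
    · rw [Finset.sum_singleton]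
      rfl
    · rw [Finset.sum_empty, MvPolynomial.coeff_zero]
      exact (MvPolynomial.isHomogeneous_X k μ).coeff_eq_zero h
  | append_singleton l β ih =>
    rw [List.pairwise_append] at hl
    have hlt : ∀ x ∈ (l : Multiset Λ), x < β := fun x hx =>
      hl.2.2 x hx β (List.mem_singleton_self β)
    have hcoe : ((l ++ [β] : List Λ) : Multiset Λ) = β ::ₘ (l : Multiset Λ) := by
      rw [Multiset.cons_coe, Multiset.coe_eq_coe]
      exact List.perm_append_singleton β l
    rw [hcoe, PlanarTree.sum_orderedTrees_cons hlt, List.map_append, nestedSeries,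
      List.foldl_append, List.map_singleton, List.foldl_cons, List.foldl_nil, ← nestedSeries,
      coeff_bracketDeriv b (Q := fun d =>
        ∑ t ∈ PlanarTree.orderedTrees (l : Multiset Λ) d, ev b (t.relabel α) μ) (ih hl.1),
      MvPolynomial.coeff_sum]
    refine Finset.sum_congr rfl fun s _ => ?_
    rw [map_sum]
    congr 1
    refine Finset.sum_congr rfl fun t ht => nodeDeriv_ev b s α ?_ μ
    rw [(PlanarTree.mem_orderedTrees.1 ht).1]
    exact fun h => lt_irrefl _ (hlt β h)

end Evaluation

/-! ### The sum over ordered trees -/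

section TreeSum

variable {k g : Type*} [Field k] [LieRing g] [LieAlgebra k g] {n : ℕ}
  (b : Module.Basis (Fin n) k g)

lemma PlanarTree.leaves_relabel {Λ Λ' : Type} (f : Λ → Λ') (t : PlanarTree Λ) :
    (t.relabel f).leaves = t.leaves := by
  induction t with
  | black => rfl
  | white a s c ih => simp only [relabel, leaves, ih]

lemma coe_rename_mul_rename (p q : MvPolynomial (Fin n) k) :
    ((MvPolynomial.rename Sum.inl p * MvPolynomial.rename Sum.inr q :
      MvPolynomial (Fin n ⊕ Fin n) k) : MvPowerSeries (Fin n ⊕ Fin n) k) =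
      tensorSeries (p : MvPowerSeries (Fin n) k) (q : MvPowerSeries (Fin n) k) := by
  classical
  ext m
  rw [coeff_tensorSeries]
  simp only [MvPolynomial.coeff_coe]
  induction p using MvPolynomial.induction_on' with
  | add p p' hp hp' => simp only [map_add, add_mul, MvPolynomial.coeff_add, hp, hp']
  | monomial d r =>
    induction q using MvPolynomial.induction_on' with
    | add q q' hq hq' => simp only [map_add, mul_add, MvPolynomial.coeff_add, hq, hq']
    | monomial e s =>
      rw [MvPolynomial.rename_monomial, MvPolynomial.rename_monomial, MvPolynomial.monomial_mul,
        ← Finsupp.sumElim_eq_add, MvPolynomial.coeff_monomial, MvPolynomial.coeff_monomial,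
        MvPolynomial.coeff_monomial]
      have h : Finsupp.sumElim d e = m ↔
          d = m.comapDomain Sum.inl Sum.inl_injective.injOn ∧
            e = m.comapDomain Sum.inr Sum.inr_injective.injOn := by
        constructor
        · rintro rfl
          constructor <;> ext i <;> simp
        · rintro ⟨rfl, rfl⟩
          exact Finsupp.comapDomain_sumElim_comapDomain m
      rw [ite_zero_mul_ite_zero]
      simp only [h]

lemma coeff_fev (t : OrderedTree) (μ : Fin n) (m : Fin n ⊕ Fin n →₀ ℕ) :
    MvPowerSeries.coeff m (fev b t μ : MvPowerSeries (Fin n ⊕ Fin n) k) =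
      ((t.w ! : ℕ) : k)⁻¹ * ∑ α : Fin t.w → Fin n,
        MvPowerSeries.coeff (m.comapDomain Sum.inl Sum.inl_injective.injOn)
          (∏ i, (MvPowerSeries.X (α i) : MvPowerSeries (Fin n) k)) *
        MvPolynomial.coeff (m.comapDomain Sum.inr Sum.inr_injective.injOn)
          (ev b (t.tree.relabel α) μ) := by
  rw [fev, MvPolynomial.coeff_coe, MvPolynomial.coeff_smul, MvPolynomial.coeff_sum, smul_eq_mul]
  congr 1
  refine Finset.sum_congr rfl fun α _ => ?_
  have h : (∏ i, MvPolynomial.X (Sum.inl (α i)) : MvPolynomial (Fin n ⊕ Fin n) k) =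
      MvPolynomial.rename Sum.inl (∏ i, MvPolynomial.X (α i)) := by simp
  have h' : ((∏ i, MvPolynomial.X (α i) : MvPolynomial (Fin n) k) : MvPowerSeries (Fin n) k) =
      ∏ i, MvPowerSeries.X (α i) := by
    rw [← MvPolynomial.coeToMvPowerSeries.ringHom_apply, map_prod]
    simp only [MvPolynomial.coeToMvPowerSeries.ringHom_apply, MvPolynomial.coe_X]
  rw [h, ← MvPolynomial.coeff_coe, coe_rename_mul_rename, coeff_tensorSeries, h',
    MvPolynomial.coeff_coe]

lemma coeff_coproduct (μ : Fin n) (m : Fin n ⊕ Fin n →₀ ℕ) {w : ℕ}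
    (hw : (m.comapDomain Sum.inl Sum.inl_injective.injOn).degree = w) :
    MvPowerSeries.coeff m (coproduct b μ) =
      ((w ! : ℕ) : k)⁻¹ * ∑ α : Fin w → Fin n,
        MvPowerSeries.coeff (m.comapDomain Sum.inl Sum.inl_injective.injOn)
          (∏ i, (MvPowerSeries.X (α i) : MvPowerSeries (Fin n) k)) *
        ∑ t ∈ PlanarTree.orderedTrees (Finset.univ : Finset (Fin w)).val
            (m.comapDomain Sum.inr Sum.inr_injective.injOn).degree,
          MvPolynomial.coeff (m.comapDomain Sum.inr Sum.inr_injective.injOn)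
            (ev b (t.relabel α) μ) := by
  subst hw
  change MvPowerSeries.coeff m (bracketTermSeries b μ _) = _
  rw [bracketTermSeries, map_smul, map_sum, smul_eq_mul]
  congr 1
  refine Finset.sum_congr rfl fun α _ => ?_
  rw [coeff_tensorSeries, List.ofFn_eq_map,
    coeff_nestedSeries b μ α _ (List.pairwise_lt_finRange _), MvPolynomial.coeff_sum]
  rfl

/-- To the coefficient of `∂^p ⊗ ∂^q` only the trees with `|p|` white and `|q|` black nodes
contribute. -/
lemma hasFormalSum_fev (μ : Fin n) :
    HasFormalSum (fun t : OrderedTree => (fev b t μ : MvPowerSeries (Fin n ⊕ Fin n) k))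
      (coproduct b μ) := by
  classical
  intro m
  obtain ⟨w, hw⟩ : ∃ w, (m.comapDomain Sum.inl Sum.inl_injective.injOn).degree = w := ⟨_, rfl⟩
  set d := (m.comapDomain Sum.inr Sum.inr_injective.injOn).degree with hd
  let T := PlanarTree.orderedTrees (Finset.univ : Finset (Fin w)).val d
  let F : {t // t ∈ T} ↪ OrderedTree :=
    ⟨fun t => ⟨w, t.1, (PlanarTree.mem_orderedTrees.1 t.2).1,
      (PlanarTree.mem_orderedTrees.1 t.2).2.1⟩, fun t t' h => by
        simp only [OrderedTree.mk.injEq, heq_eq_eq, true_and] at h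
        exact Subtype.ext h⟩
  have hsub : {t : OrderedTree | MvPowerSeries.coeff m
      (fev b t μ : MvPowerSeries (Fin n ⊕ Fin n) k) ≠ 0} ⊆ (T.attach.map F : Finset OrderedTree) := by
    intro t ht
    rw [Set.mem_ofPred_eq, coeff_fev] at ht
    obtain ⟨α, -, hα⟩ := Finset.exists_ne_zero_of_sum_ne_zero (right_ne_zero_of_mul ht)
    have h1 : t.w = w := by
      by_contra hne
      exact left_ne_zero_of_mul hα (coeff_prod_X_of_degree_ne α fun h => hne (by rw [← h, hw]))
    have h2 : t.tree.leaves = d := by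
      by_contra hne
      refine right_ne_zero_of_mul hα ((isHomogeneous_ev b _ μ).coeff_eq_zero fun h => hne ?_)
      rw [hd, h, PlanarTree.leaves_relabel]
    obtain ⟨w', t, hn, hdesc⟩ := t
    obtain rfl : w' = w := h1
    rw [Finset.mem_coe, Finset.mem_map]
    exact ⟨⟨t, PlanarTree.mem_orderedTrees.2 ⟨hn, hdesc, h2⟩⟩, Finset.mem_attach _ _, rfl⟩
  refine ⟨(Finset.finite_toSet _).subset hsub, ?_⟩
  rw [finsum_eq_sum_of_support_subset _ hsub, Finset.sum_map, coeff_coproduct b μ m hw]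
  simp only [coeff_fev, Finset.mul_sum]
  rw [Finset.sum_comm, ← Finset.sum_attach]
  rfl

end TreeSum

end

end SymOrd

theorem mainTheorem3 {k g : Type*} [Field k] [CharZero k] [LieRing g] [LieAlgebra k g] {n : ℕ}
    (b : Module.Basis (Fin n) k g) (μ : Fin n) :
    Function.Bijective (SymOrd.coexp b) ∧
    (∀ (w : ℕ) (α : Fin w → Fin n), ∃ P : MvPowerSeries (Fin n) k,
      SymOrd.hat b P = SymOrd.nestedBracket b μ α) ∧
    ∃ D : MvPowerSeries (Fin n ⊕ Fin n) k,
      SymOrd.IsDeformedCoproduct b μ D ∧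
      (∀ D' : MvPowerSeries (Fin n ⊕ Fin n) k, SymOrd.IsDeformedCoproduct b μ D' → D' = D) ∧
      SymOrd.HasPointwiseSum (SymOrd.bracketTerm b μ) (SymOrd.hat₂ b D) ∧
      SymOrd.HasPointwiseSum (SymOrd.expTerm b μ) (SymOrd.hat₂ b D) ∧
      SymOrd.HasFormalSum
        (fun t : SymOrd.OrderedTree =>
          (SymOrd.fev b t μ : MvPowerSeries (Fin n ⊕ Fin n) k)) D := by
  have hsum := SymOrd.hasPointwiseSum_bracketTerm b μ
  have hcop := SymOrd.isDeformedCoproduct_coproduct b μ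
  refine ⟨SymOrd.coexp_bijective b, fun w α => ⟨_, (SymOrd.nestedBracket_eq_hat b μ α).symm⟩,
    SymOrd.coproduct b μ, hcop, fun D' h => hcop.unique b h, hsum, ?_,
    SymOrd.hasFormalSum_fev b μ⟩
  rwa [show SymOrd.expTerm b μ = SymOrd.bracketTerm b μ from
    funext (SymOrd.expTerm_eq_bracketTerm b μ)]
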